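/- Setting. Let $\mathcal P$ be a finite set of labelled prototiles in $\mathbb R^d$, that is, compact sets equal to the closure of their interior, each with a chosen puncture in its interior. A tile $t=p+y$ is a translate of a prototile and has puncture $x(t)=x(p)+y$. Two tiles are adjacent if their supports intersect; a patch is a finite set of tiles with pairwise disjoint interiors that is connected through adjacent tiles. Let $\varphi$ be a substitution: each $p\in\mathcal P$ is sent to a patch $\varphi(p)$ with support $\lambda\cdot\mathrm{supp}(p)$, for some $\lambda>1$; put $\varphi(p+x)=\varphi(p)+\lambda x$. Let $\Omega_\varphi$ be the set of admitted tilings (each finite sub-patch is contained in a translate of some $\varphi^n(p)$). Assume that * $\varphi$ has finite local complexity: up to translation, only finitely many two-tile patches occur in the patches $\varphi^n(p)$; * $\varphi$ is recognisable (the aperiodic case): $\varphi\colon\Omega_\varphi\to\Omega_\varphi$ is injective; * $\varphi$ forces the border: for some $k$, each $k$-supertile $\varphi^k(p)$ occurs in an admitted tiling, and the tiles surrounding it there are determined by $p$. Let $\mathcal S$ be the set of supertile extensions $(t,p)$, $t\in\varphi(p)$, regarded as edges with source $p$ and range the prototile of $t$, and let $\mathcal F=\{e_0e_1\cdots\mid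 s(e_i)=r(e_{i+1})\}$ with shift $\sigma$; $\mathcal F^k$ is the set of finite paths of length $k$. Let $\tau\colon\mathcal F\to\Omega_{\mathrm{punc}}$ be the bijection onto the set of admitted tilings with a puncture at the origin, which sends $(t_0,t_1)(t_1,t_2)\cdots$ to the tiling $T$ whose tile at the origin is $t_0$ and whose level-$n$ supertile at the origin is $\varphi^n(t_n)$, with $t_0\subseteq\varphi(t_1)\subseteq\varphi^2(t_2)\subseteq\cdots$ embedded as prescribed. Let $\mathcal T$ be the tiling semigroup: its elements are $0$ and the doubly pointed patches $[b,P,a]$ ($P$ a patch occurring in an admitted tiling, $a,b\in P$), up to translation, with $[d,Q,c][b,P,a]=[d,P\cup Q,a]$ if, after translating so that $x(b)=x(c)$, $P\cup Q$ is a patch occurring in an admitted tiling, and all other products $0$. It acts on $\mathcal F$ by partial bijections: $\mathrm{dom}[b,P,a]=\{w\mid P-x(a)\subset\tau(w)\}$ and $\tau([b,P,a]\cdot w)=\tau(w)-(x(b)-x(a))$; $0$ has empty domain. A self-similar action on $\mathcal F$ is an action of an inverse semigroup $G$ by partial bijections such that for all $g\in G$ and $x\in\mathcal S$ there are $y_1,\dots,y_k\in\mathcal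 S$ and $h_1,\dots,h_k\in G$ with disjoint domains, $\bigcup_i x\,\mathrm{dom}(h_i)=x\mathcal F\cap\mathrm{dom}(g)$, and $g\cdot xw=y_i(h_i\cdot w)$ for $w\in\mathrm{dom}(h_i)$. It is contracting if there is a finite $N\subseteq G$ such that for every $g\in G$ there is $k\in\mathbb N$ so that for all $uw\in\mathrm{dom}(g)$ with $u\in\mathcal F^k$ there are $v\in\mathcal F^k$ and $h\in N$ with $g\cdot(uw)=v(h\cdot w)$. A semi-nucleus is a finite set $N$ with this property such that moreover for all $g\in N$ and $ew\in\mathrm{dom}(g)$, $e\in\mathcal S$, there are $f\in\mathcal S$ and $h\in N$ with $g\cdot(ew)=f(h\cdot w)$. Proposition. 1. For each $g\in\mathcal T$ there is $k=k(g)\in\mathbb N$ so that for all $uw\in\mathrm{dom}(g)$ with $u\in\mathcal F^k$ we have $g\cdot(uw)=v(h\cdot w)$ for some $v\in\mathcal F^k$ and some $h=[b,P,a]\in\mathcal T$ for which $a=b$ or $a$ and $b$ are adjacent. 2. The action of $\mathcal T$ on $\mathcal F$ is a contracting self-similar inverse semigroup action. 3. The set of all doubly pointed star patches $[b,P,a]$,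 that is, with all tiles of $P$ sharing a common point, is a semi-nucleus. -/

import Mathlib

/-! ## Topological Markov chains and actions by partial bijections -/

/-- Right-infinite paths `e₀ e₁ e₂ ⋯` with `s (eᵢ) = r (eᵢ₊₁)` in the graph with edge set `X`, vertex
set `V`, range map `r` and source map `s`. -/
def PathSpace {X V : Type*} (r s : X → V) : Type _ :=
  {w : Stream' X // ∀ i, s (w.get i) = r (w.get (i + 1))}

/-- An inverse semigroup: an associative product such that every element has a unique inverse. -/
def IsInverseSemigroup (G : Type*) [Mul G] : Prop :=
  (∀ a b c : G, a * b * c = a * (b * c)) ∧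
    ∀ a : G, ∃! b : G, a * b * a = a ∧ b * a * b = b

section Actions

variable {X V G : Type*} {r s : X → V}

/-- `π` is a homomorphism from `G` to the partial bijections of the path space. -/
def IsPartialAction [Mul G] (π : G → PathSpace r s →. PathSpace r s) : Prop :=
  (∀ g : G, ∀ w w' y : PathSpace r s, y ∈ π g w → y ∈ π g w' → w = w') ∧
    ∀ g f : G, π (g * f) = (π g).comp (π f)

/-- The equation `g · z = v (h · w)`, as an equality of partially defined infinite words:
either both sides are undefined, or both are defined and equal. -/
def RestrictsTo (π : G → PathSpace r s →. PathSpace r s) (g : G) (z : PathSpace r s)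
    (v : List X) (h : G) (w : PathSpace r s) : Prop :=
  (π g z).map (fun y => y.1) = (π h w).map (fun y => v ++ₛ y.1)

/-- A self-similar inverse semigroup action on the path space. -/
def IsSelfSimilar [Mul G] (π : G → PathSpace r s →. PathSpace r s) : Prop :=
  IsInverseSemigroup G ∧ IsPartialAction π ∧
    ∀ (g : G) (x : X), ∃ (k : ℕ) (y : Fin k → X) (h : Fin k → G),
      (∀ i j, i ≠ j → Disjoint (π (h i)).Dom (π (h j)).Dom) ∧
      (⋃ i, {z : Stream' X | ∃ w ∈ (π (h i)).Dom, z = Stream'.cons x w.1}) =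
        {z : Stream' X | z.head = x ∧ ∃ z' ∈ (π g).Dom, z'.1 = z} ∧
      ∀ (i : Fin k) (z w : PathSpace r s), z.1 = Stream'.cons x w.1 → w ∈ (π (h i)).Dom →
        RestrictsTo π g z [y i] (h i) w

/-- The finite set `N` satisfies the contracting condition: for every `g` there is `k` such that
for every `z = u w ∈ dom g` with `|u| = k` one has `g · (u w) = v (h · w)` for some word `v` of
length `k` and some `h ∈ N`. (As `z` and `g · z` are paths, `u` and `v` are finite paths.) -/
def ContractsTo (π : G → PathSpace r s →. PathSpace r s) (N : Set G) : Prop :=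
  N.Finite ∧ ∀ g : G, ∃ k : ℕ, ∀ (u : List X) (w z : PathSpace r s),
    u.length = k → z.1 = u ++ₛ w.1 → z ∈ (π g).Dom →
      ∃ v : List X, v.length = k ∧ ∃ h ∈ N, RestrictsTo π g z v h w

/-- A contracting self-similar inverse semigroup action. -/
def IsContracting [Mul G] (π : G → PathSpace r s →. PathSpace r s) : Prop :=
  IsSelfSimilar π ∧ ∃ N : Set G, ContractsTo π N

/-- `N` is a semi-nucleus: it satisfies the contracting condition, and a single restriction of an
element of `N` can be taken in `N`. -/
def IsSemiNucleus (π : G → PathSpace r s →. PathSpace r s) (N : Set G) : Prop :=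
  ContractsTo π N ∧ ∀ g ∈ N, ∀ (e : X) (w z : PathSpace r s),
    z.1 = Stream'.cons e w.1 → z ∈ (π g).Dom → ∃ f : X, ∃ h ∈ N, RestrictsTo π g z [f] h w

end Actions

/-! ## Tiles, patches and tilings -/

/-- A finite labelled family of punctured prototiles in `ℝᵈ`, indexed by their labels `P`. -/
structure Prototiles (d : ℕ) (P : Type*) where
  /-- the support of a prototile -/
  supp : P → Set (EuclideanSpace ℝ (Fin d))
  isCompact_supp : ∀ p, IsCompact (supp p)
  closure_interior_supp : ∀ p, closure (interior (supp p)) = supp p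
  /-- the chosen puncture of a prototile -/
  puncture : P → EuclideanSpace ℝ (Fin d)
  puncture_mem : ∀ p, puncture p ∈ interior (supp p)

/-- The tile `(p, x)` is the translate `p + x` of the prototile `p`. -/
abbrev Tile (d : ℕ) (P : Type*) := P × EuclideanSpace ℝ (Fin d)

/-- The translate `T + x` of a set of tiles. -/
def translateTiles {d : ℕ} {P : Type*} (T : Set (Tile d P)) (x : EuclideanSpace ℝ (Fin d)) :
    Set (Tile d P) :=
  (fun t => (t.1, t.2 + x)) '' T

namespace Prototiles

variable {d : ℕ} {P : Type*} (A : Prototiles d P)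

/-- The support of a tile. -/
def tileSupp (t : Tile d P) : Set (EuclideanSpace ℝ (Fin d)) :=
  (fun y => y + t.2) '' A.supp t.1

/-- The support of a set of tiles. -/
def setSupp (Q : Set (Tile d P)) : Set (EuclideanSpace ℝ (Fin d)) :=
  ⋃ t ∈ Q, A.tileSupp t

/-- The puncture of a tile. -/
def tilePuncture (t : Tile d P) : EuclideanSpace ℝ (Fin d) :=
  A.puncture t.1 + t.2

/-- Two tiles are adjacent if their supports intersect. -/
def Adjacent (t t' : Tile d P) : Prop :=
  (A.tileSupp t ∩ A.tileSupp t').Nonempty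

/-- Distinct tiles overlap at most on their boundaries. -/
def NonOverlapping (Q : Set (Tile d P)) : Prop :=
  ∀ t ∈ Q, ∀ t' ∈ Q, t ≠ t' → Disjoint (interior (A.tileSupp t)) (interior (A.tileSupp t'))

/-- Any two tiles of `Q` are joined by a path of adjacent tiles in `Q`. -/
def Connected (Q : Set (Tile d P)) : Prop :=
  ∀ t ∈ Q, ∀ t' ∈ Q,
    Relation.ReflTransGen (fun a b => a ∈ Q ∧ b ∈ Q ∧ A.Adjacent a b) t t'

/-- A patch: a finite connected set of tiles overlapping only on their boundaries. -/
def IsPatch (Q : Set (Tile d P)) : Prop :=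
  Q.Finite ∧ A.NonOverlapping Q ∧ A.Connected Q

/-- A tiling of `ℝᵈ`. -/
def IsTiling (T : Set (Tile d P)) : Prop :=
  A.setSupp T = Set.univ ∧ A.NonOverlapping T

end Prototiles

/-- A (stone inflation) substitution: each prototile `p` is mapped to a patch with support
`λ · supp p`, where `λ > 1`. -/
structure TileSubstitution (d : ℕ) (P : Type*) extends Prototiles d P where
  /-- the scaling factor `λ` -/
  scale : ℝ
  one_lt_scale : 1 < scale
  /-- the patch `φ(p)` -/
  sub : P → Set (Tile d P)
  isPatch_sub : ∀ p, toPrototiles.IsPatch (sub p)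
  setSupp_sub : ∀ p, toPrototiles.setSupp (sub p) = (fun y => scale • y) '' supp p

namespace TileSubstitution

variable {d : ℕ} {P : Type*} (S : TileSubstitution d P)

/-- `φ` on sets of tiles: the union of `φ(p) + λ x` over the tiles `p + x` of the set. -/
def subst (T : Set (Tile d P)) : Set (Tile d P) :=
  ⋃ t ∈ T, translateTiles (S.sub t.1) (S.scale • t.2)

/-- The patch `φⁿ(p)`; its translates are the `n`-supertiles. -/
def supertile (n : ℕ) (p : P) : Set (Tile d P) :=
  S.subst^[n] {(p, 0)}

/-- The set `Ω_φ` of admitted tilings. (Every finite set of tiles of a tiling is contained in a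
finite connected one, so one may quantify over all finite subsets instead of connected ones.) -/
def hull : Set (Set (Tile d P)) :=
  {T | S.IsTiling T ∧ ∀ Q ⊆ T, Q.Finite → ∃ n p x, Q ⊆ translateTiles (S.supertile n p) x}

/-- Finite local complexity: up to translation, only finitely many two-tile patches occur in the
patches `φⁿ(p)`. -/
def FLC : Prop :=
  {q : P × P × EuclideanSpace ℝ (Fin d) | ∃ n p, ∃ t ∈ S.supertile n p, ∃ t' ∈ S.supertile n p,
    t ≠ t' ∧ S.Adjacent t t' ∧ q = (t.1, t'.1, t'.2 - t.2)}.Finite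

/-- Recognisability: `φ` is injective on `Ω_φ`. -/
def Recognisable : Prop :=
  Set.InjOn S.subst S.hull

/-- The tiles of `T` that intersect the support of `Q`. -/
def corona (T Q : Set (Tile d P)) : Set (Tile d P) :=
  {t ∈ T | (S.tileSupp t ∩ S.setSupp Q).Nonempty}

/-- The substitution forces the border: for some `k`, each `φᵏ(p)` occurs in an admitted tiling, and
the tiles around a `k`-supertile `φᵏ(p)` are the same wherever `φᵏ(p)` arises from a tile of type `p`
of an admitted tiling. -/
def ForcesBorder : Prop :=
  ∃ k : ℕ, ∀ p : P, (∃ T ∈ S.hull, S.supertile k p ⊆ T) ∧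
    ∀ T ∈ S.hull, ∀ T' ∈ S.hull, (p, 0) ∈ T → (p, 0) ∈ T' →
      S.corona (S.subst^[k] T) (S.supertile k p) = S.corona (S.subst^[k] T') (S.supertile k p)

/-- The discrete hull: admitted tilings with a puncture over the origin. -/
def puncturedHull : Set (Set (Tile d P)) :=
  {T ∈ S.hull | ∃ t ∈ T, S.tilePuncture t = 0}

/-! ## The substitution graph and the coding of tilings -/

/-- Supertile extensions `(t, p)` with `t ∈ φ(p)`. -/
def Ext : Type _ := {e : Tile d P × P // e.1 ∈ S.sub e.2}

/-- The range of a supertile extension `(t, p)`: the prototile of `t`. -/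
def extRange (e : S.Ext) : P := e.1.1.1

/-- The source of a supertile extension `(t, p)`: the prototile `p`. -/
def extSource (e : S.Ext) : P := e.1.2

/-- The topological Markov chain `𝓕` of the substitution graph. -/
abbrev Chain : Type _ := PathSpace S.extRange S.extSource

/-- For `w = (t₀,t₁)(t₁,t₂)⋯`, the translation vector of the level-`n` tile `tₙ`, when `t₀` has its
puncture over the origin and `φ(tₙ₊₁)` contains `tₙ` in the way that is prescribed by `(tₙ,tₙ₊₁)`. -/
noncomputable def pos (w : S.Chain) : ℕ → EuclideanSpace ℝ (Fin d)
  | 0 => -S.puncture (S.extRange (w.1.get 0))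
  | n + 1 => S.scale⁻¹ • (pos w n - (w.1.get n).1.1.2)

/-- `T` is a tiling coded by `w`: for a hierarchy `T = T₀, T₁, T₂, …` of admitted tilings with
`φ(Tₙ₊₁) = Tₙ`, the tile `tₙ` of `w`, in its prescribed position, belongs to `Tₙ`, for each `n`. -/
def Codes (w : S.Chain) (T : Set (Tile d P)) : Prop :=
  ∃ H : ℕ → Set (Tile d P), H 0 = T ∧ ∀ n, H n ∈ S.hull ∧ S.subst (H (n + 1)) = H n ∧
    (S.extRange (w.1.get n), S.pos w n) ∈ H n

/-- The map `τ : 𝓕 → Ω_punc`. For a recognisable, border forcing substitution with finite local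
complexity each `w` codes exactly one tiling, and `τ` is a bijection onto the discrete hull. -/
noncomputable def tau (w : S.Chain) : Set (Tile d P) :=
  Classical.epsilon (S.Codes w)

/-! ## The tiling semigroup -/

/-- A patch that occurs in an admitted tiling. -/
def IsAdmittedPatch (Q : Set (Tile d P)) : Prop :=
  S.IsPatch Q ∧ ∃ T ∈ S.hull, Q ⊆ T

/-- A doubly pointed patch `[b, P, a]` with in-tile `a` and out-tile `b`. Such triples are taken up
to translation; each class is represented by its unique member with the puncture of `a` at `0`. -/
structure PointedPatch where
  /-- the underlying patch -/
  tiles : Set (Tile d P)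
  /-- the in-tile -/
  inTile : Tile d P
  /-- the out-tile -/
  outTile : Tile d P
  inTile_mem : inTile ∈ tiles
  outTile_mem : outTile ∈ tiles
  isAdmittedPatch : S.IsAdmittedPatch tiles
  tilePuncture_inTile : S.tilePuncture inTile = 0

/-- The tiling semigroup: all doubly pointed patches, and a zero element. -/
inductive TilingSemigroup where
  | zero : TilingSemigroup
  | patch (g : S.PointedPatch) : TilingSemigroup

open Classical in
/-- `[d, Q, c] [b, P, a] = [d, P ∪ Q, a]` after translating `Q` so that the punctures of `b` and `c`
agree, if then `P ∪ Q` is an admitted patch; all other products are zero. -/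
noncomputable instance : Mul S.TilingSemigroup where
  mul
    | .patch g, .patch f =>
      if h : S.IsAdmittedPatch (f.tiles ∪ translateTiles g.tiles (S.tilePuncture f.outTile)) then
        .patch
          { tiles := f.tiles ∪ translateTiles g.tiles (S.tilePuncture f.outTile)
            inTile := f.inTile
            outTile := (g.outTile.1, g.outTile.2 + S.tilePuncture f.outTile)
            inTile_mem := Or.inl f.inTile_mem
            outTile_mem := Or.inr ⟨g.outTile, g.outTile_mem, rfl⟩
            isAdmittedPatch := h
            tilePuncture_inTile := f.tilePuncture_inTile }
      else .zero
    | _, _ => .zero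

/-- The action of the tiling semigroup on `𝓕 ≅ Ω_punc`: the domain of `[b, P, a]` consists of the
`w` whose tiling `τ(w)` contains `P` (with the puncture of `a` at `0`), and then
`τ([b, P, a] · w) = τ(w) - x(b)`. The zero element has empty domain. -/
noncomputable def action : S.TilingSemigroup → S.Chain →. S.Chain
  | .zero => fun _ => Part.none
  | .patch g => fun w =>
      ⟨S.tau w ∈ S.puncturedHull ∧ g.tiles ⊆ S.tau w, fun _ =>
        haveI : Nonempty S.Chain := ⟨w⟩
        Function.invFun S.tau (translateTiles (S.tau w) (-S.tilePuncture g.outTile))⟩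

/-- The doubly pointed star patches: the tiles of the patch all share a common point. -/
def starPatches : Set S.TilingSemigroup :=
  {s | ∃ g : S.PointedPatch, s = .patch g ∧ ∃ y, ∀ t ∈ g.tiles, y ∈ S.tileSupp t}

end TileSubstitution

/-! A path records the successive ancestors of the tile at the origin. By recognisability a tiling T
has at most one hierarchy H 0 = T, H 1, … of admitted tilings with φ(H (n+1)) = H n
(`IsHierarchy.eq_of_zero_eq`). By border forcing a sequence of ancestors determines all levels,
since the coronas of its growing supertiles exhaust space (`ForcesBorderAt.coronaLimit_mem_hull`,
`ForcesBorderAt.eq_coronaLimit`). So τ is well defined and injective, and [b, P, a] replaces the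
ancestor path of a by that of b inside one hierarchy. Deleting n edges from both paths leaves the
ancestor paths of the level-n ancestors, so the restriction is given by the patch of level-n
ancestors of the tiles of P (`ForcesBorder.exists_restrictsTo_ancestors`).

Contraction is then geometric. With x(a) = 0, the level-n ancestor of a tile t contains λ⁻ⁿ x(t), so
for large n all ancestors of P come close to the origin, which lies in the ancestor of a. Tiles that
close have a common point (`ForcesBorder.exists_common_point`): border forcing makes nearby tiles
adjacent, and finite local complexity leaves finitely many configurations of neighbours. Hence the
ancestors form a star patch, and there are only finitely many star patches. If y is common to a
star, λ⁻¹ y is common to its parents, whence the semi-nucleus.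

For self-similarity, the edge x fixes the parent of a; since P is connected, finite local complexity
leaves finitely many patches of parents (`FLC.finite_isParentPatch`), and no two of them fit into
one tiling (`IsParentPatch.eq_of_tiles_subset`), so their domains are disjoint. -/

section Translate

variable {d : ℕ} {P : Type*}

theorem mem_translateTiles {T : Set (Tile d P)} {x : EuclideanSpace ℝ (Fin d)} {t : Tile d P} :
    t ∈ translateTiles T x ↔ (t.1, t.2 - x) ∈ T := by
  constructor
  · rintro ⟨s, hs, rfl⟩
    simpa using hs
  · intro h
    exact ⟨_, h, by simp⟩

theorem translateTiles_translateTiles (T : Set (Tile d P)) (x y : EuclideanSpace ℝ (Fin d)) :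
    translateTiles (translateTiles T x) y = translateTiles T (x + y) := by
  ext t
  simp only [mem_translateTiles]
  rw [show t.2 - y - x = t.2 - (x + y) by abel]

theorem translateTiles_zero (T : Set (Tile d P)) : translateTiles T 0 = T := by
  ext t
  simp [mem_translateTiles]

theorem translateTiles_neg_add_cancel (T : Set (Tile d P)) (x : EuclideanSpace ℝ (Fin d)) :
    translateTiles (translateTiles T (-x)) x = T := by
  rw [translateTiles_translateTiles, neg_add_cancel, translateTiles_zero]

theorem translateTiles_mono {T T' : Set (Tile d P)} (h : T ⊆ T') (x : EuclideanSpace ℝ (Fin d)) :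
    translateTiles T x ⊆ translateTiles T' x :=
  Set.image_mono h

theorem translateTiles_union (T T' : Set (Tile d P)) (x : EuclideanSpace ℝ (Fin d)) :
    translateTiles (T ∪ T') x = translateTiles T x ∪ translateTiles T' x :=
  Set.image_union ..

theorem translateTiles_subset_iff {T T' : Set (Tile d P)} {x : EuclideanSpace ℝ (Fin d)} :
    translateTiles T x ⊆ T' ↔ T ⊆ translateTiles T' (-x) := by
  constructor
  · intro h
    have := translateTiles_mono h (-x)
    rwa [translateTiles_translateTiles, add_neg_cancel, translateTiles_zero] at this
  · intro h
    have := translateTiles_mono h x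
    rwa [translateTiles_neg_add_cancel] at this

theorem translateTiles_singleton (t : Tile d P) (x : EuclideanSpace ℝ (Fin d)) :
    translateTiles {t} x = {(t.1, t.2 + x)} :=
  Set.image_singleton

theorem mem_translateTiles_of_mem {T : Set (Tile d P)} {t : Tile d P} (h : t ∈ T)
    (x : EuclideanSpace ℝ (Fin d)) : (t.1, t.2 + x) ∈ translateTiles T x :=
  ⟨t, h, rfl⟩

end Translate

/-! ### Geometry of tiles, patches and tilings -/

namespace Prototiles

variable {d : ℕ} {P : Type*} (A : Prototiles d P)

theorem mem_tileSupp {t : Tile d P} {y : EuclideanSpace ℝ (Fin d)} :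
    y ∈ A.tileSupp t ↔ y - t.2 ∈ A.supp t.1 := by
  constructor
  · rintro ⟨z, hz, rfl⟩
    simpa using hz
  · intro h
    exact ⟨_, h, by simp⟩

theorem mem_tileSupp_translate {t : Tile d P} {x y : EuclideanSpace ℝ (Fin d)} :
    y ∈ A.tileSupp (t.1, t.2 + x) ↔ y - x ∈ A.tileSupp t := by
  rw [mem_tileSupp, mem_tileSupp, sub_add_eq_sub_sub_swap]

theorem tileSupp_translate (t : Tile d P) (x : EuclideanSpace ℝ (Fin d)) :
    A.tileSupp (t.1, t.2 + x) = Homeomorph.addRight (-x) ⁻¹' A.tileSupp t := by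
  ext y
  rw [mem_tileSupp_translate]
  simp [sub_eq_add_neg]

theorem tilePuncture_translate (t : Tile d P) (x : EuclideanSpace ℝ (Fin d)) :
    A.tilePuncture (t.1, t.2 + x) = A.tilePuncture t + x := by
  simp [tilePuncture, add_assoc]

theorem isCompact_tileSupp (t : Tile d P) : IsCompact (A.tileSupp t) :=
  (A.isCompact_supp t.1).image (by fun_prop)

theorem tileSupp_eq_image (t : Tile d P) :
    A.tileSupp t = Homeomorph.addRight t.2 '' A.supp t.1 := rfl

theorem closure_interior_tileSupp (t : Tile d P) :
    closure (interior (A.tileSupp t)) = A.tileSupp t := by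
  rw [tileSupp_eq_image, ← Homeomorph.image_interior, ← Homeomorph.image_closure,
    A.closure_interior_supp]

theorem tilePuncture_mem_interior (t : Tile d P) :
    A.tilePuncture t ∈ interior (A.tileSupp t) := by
  rw [tileSupp_eq_image, ← Homeomorph.image_interior]
  exact ⟨_, A.puncture_mem t.1, rfl⟩

theorem tilePuncture_mem (t : Tile d P) : A.tilePuncture t ∈ A.tileSupp t :=
  interior_subset (A.tilePuncture_mem_interior t)

theorem mem_setSupp {Q : Set (Tile d P)} {y : EuclideanSpace ℝ (Fin d)} :
    y ∈ A.setSupp Q ↔ ∃ t ∈ Q, y ∈ A.tileSupp t := by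
  simp [setSupp]

theorem setSupp_mono {Q Q' : Set (Tile d P)} (h : Q ⊆ Q') : A.setSupp Q ⊆ A.setSupp Q' :=
  Set.biUnion_subset_biUnion_left h

theorem setSupp_singleton (t : Tile d P) : A.setSupp {t} = A.tileSupp t := by
  simp [setSupp]

theorem mem_setSupp_translate {Q : Set (Tile d P)} {x y : EuclideanSpace ℝ (Fin d)} :
    y ∈ A.setSupp (translateTiles Q x) ↔ y - x ∈ A.setSupp Q := by
  simp only [mem_setSupp]
  constructor
  · rintro ⟨_, ⟨s, hs, rfl⟩, hy⟩
    exact ⟨s, hs, A.mem_tileSupp_translate.1 hy⟩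
  · rintro ⟨s, hs, hy⟩
    exact ⟨_, ⟨s, hs, rfl⟩, A.mem_tileSupp_translate.2 hy⟩

variable {A}

theorem Adjacent.refl (t : Tile d P) : A.Adjacent t t :=
  ⟨_, A.tilePuncture_mem t, A.tilePuncture_mem t⟩

theorem Adjacent.translate {t t' : Tile d P} (h : A.Adjacent t t')
    (x : EuclideanSpace ℝ (Fin d)) : A.Adjacent (t.1, t.2 + x) (t'.1, t'.2 + x) := by
  obtain ⟨y, hy, hy'⟩ := h
  exact ⟨y + x, A.mem_tileSupp_translate.2 (by simpa), A.mem_tileSupp_translate.2 (by simpa)⟩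

theorem NonOverlapping.mono {Q Q' : Set (Tile d P)} (h : A.NonOverlapping Q') (hQ : Q ⊆ Q') :
    A.NonOverlapping Q :=
  fun t ht t' ht' => h t (hQ ht) t' (hQ ht')

/-- A support is the closure of its interior, so a neighbourhood of a point of the support of `u`
meets the interior of `u`. -/
theorem NonOverlapping.eq_of_mem {T : Set (Tile d P)} (h : A.NonOverlapping T) {t u : Tile d P}
    (ht : t ∈ T) (hu : u ∈ T) {y : EuclideanSpace ℝ (Fin d)} (hy : y ∈ interior (A.tileSupp t))
    (hy' : y ∈ A.tileSupp u) : t = u := by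
  by_contra hne
  rw [← A.closure_interior_tileSupp] at hy'
  obtain ⟨z, hz, hz'⟩ := mem_closure_iff.1 hy' _ isOpen_interior hy
  exact Set.disjoint_left.1 (h t ht u hu hne) hz hz'

theorem NonOverlapping.eq_of_tilePuncture_eq {T : Set (Tile d P)} (h : A.NonOverlapping T)
    {t u : Tile d P} (ht : t ∈ T) (hu : u ∈ T) (htu : A.tilePuncture t = A.tilePuncture u) :
    t = u :=
  h.eq_of_mem ht hu (A.tilePuncture_mem_interior t) (htu ▸ A.tilePuncture_mem u)

theorem NonOverlapping.translate {T : Set (Tile d P)} (h : A.NonOverlapping T)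
    (x : EuclideanSpace ℝ (Fin d)) : A.NonOverlapping (translateTiles T x) := by
  rintro _ ⟨t, ht, rfl⟩ _ ⟨u, hu, rfl⟩ hne
  rw [tileSupp_translate, tileSupp_translate, ← Homeomorph.preimage_interior,
    ← Homeomorph.preimage_interior]
  exact (h t ht u hu (fun e => hne (e ▸ rfl))).preimage _

theorem IsTiling.translate {T : Set (Tile d P)} (h : A.IsTiling T)
    (x : EuclideanSpace ℝ (Fin d)) : A.IsTiling (translateTiles T x) := by
  refine ⟨Set.eq_univ_of_forall fun y => ?_, h.2.translate x⟩
  rw [mem_setSupp_translate, h.1]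
  trivial

/-- The puncture of an extra tile would already be covered by a tile of `T`. -/
theorem IsTiling.eq_of_subset {T T' : Set (Tile d P)} (h : A.IsTiling T)
    (h' : A.NonOverlapping T') (hT : T ⊆ T') : T = T' := by
  refine hT.antisymm fun t ht => ?_
  obtain ⟨u, hu, hy⟩ := A.mem_setSupp.1 (h.1.symm ▸ Set.mem_univ (A.tilePuncture t))
  rwa [h'.eq_of_mem ht (hT hu) (A.tilePuncture_mem_interior t) hy]

theorem Connected.translate {Q : Set (Tile d P)} (h : A.Connected Q)
    (x : EuclideanSpace ℝ (Fin d)) : A.Connected (translateTiles Q x) := by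
  rintro _ ⟨t, ht, rfl⟩ _ ⟨u, hu, rfl⟩
  refine Relation.ReflTransGen.lift (fun t : Tile d P => (t.1, t.2 + x)) ?_ _ _ (h t ht u hu)
  rintro a b ⟨ha, hb, hab⟩
  exact ⟨⟨a, ha, rfl⟩, ⟨b, hb, rfl⟩, hab.translate x⟩

theorem Connected.union {Q Q' : Set (Tile d P)} (h : A.Connected Q) (h' : A.Connected Q')
    {t : Tile d P} (ht : t ∈ Q) (ht' : t ∈ Q') : A.Connected (Q ∪ Q') := by
  have hl : (fun a b => a ∈ Q ∧ b ∈ Q ∧ A.Adjacent a b) ≤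
      fun a b => a ∈ Q ∪ Q' ∧ b ∈ Q ∪ Q' ∧ A.Adjacent a b :=
    fun a b hab => ⟨Or.inl hab.1, Or.inl hab.2.1, hab.2.2⟩
  have hr : (fun a b => a ∈ Q' ∧ b ∈ Q' ∧ A.Adjacent a b) ≤
      fun a b => a ∈ Q ∪ Q' ∧ b ∈ Q ∪ Q' ∧ A.Adjacent a b :=
    fun a b hab => ⟨Or.inr hab.1, Or.inr hab.2.1, hab.2.2⟩
  have key : ∀ u ∈ Q ∪ Q', Relation.ReflTransGen
      (fun a b => a ∈ Q ∪ Q' ∧ b ∈ Q ∪ Q' ∧ A.Adjacent a b) t u ∧ Relation.ReflTransGen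
      (fun a b => a ∈ Q ∪ Q' ∧ b ∈ Q ∪ Q' ∧ A.Adjacent a b) u t := by
    rintro u (hu | hu)
    · exact ⟨Relation.ReflTransGen.mono hl _ _ (h t ht u hu),
        Relation.ReflTransGen.mono hl _ _ (h u hu t ht)⟩
    · exact ⟨Relation.ReflTransGen.mono hr _ _ (h' t ht' u hu),
        Relation.ReflTransGen.mono hr _ _ (h' u hu t ht')⟩
  exact fun a ha b hb => (key a ha).2.trans (key b hb).1

theorem IsPatch.translate {Q : Set (Tile d P)} (h : A.IsPatch Q)
    (x : EuclideanSpace ℝ (Fin d)) : A.IsPatch (translateTiles Q x) :=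
  ⟨h.1.image _, h.2.1.translate x, h.2.2.translate x⟩

end Prototiles

/-! ### Substitution of sets of tiles and of admitted tilings -/

namespace TileSubstitution

variable {d : ℕ} {P : Type*} (S : TileSubstitution d P)

theorem scale_pos : 0 < S.scale := zero_lt_one.trans S.one_lt_scale

theorem scale_ne_zero : S.scale ≠ 0 := S.scale_pos.ne'

theorem mem_subst {T : Set (Tile d P)} {t : Tile d P} :
    t ∈ S.subst T ↔ ∃ s ∈ T, (t.1, t.2 - S.scale • s.2) ∈ S.sub s.1 := by
  simp only [subst, Set.mem_iUnion, mem_translateTiles, exists_prop]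

theorem subst_mono {T T' : Set (Tile d P)} (h : T ⊆ T') : S.subst T ⊆ S.subst T' :=
  Set.biUnion_subset_biUnion_left h

theorem subst_iterate_mono (n : ℕ) {T T' : Set (Tile d P)} (h : T ⊆ T') :
    S.subst^[n] T ⊆ S.subst^[n] T' :=
  (show Monotone S.subst from fun _ _ => S.subst_mono).iterate n h

theorem subst_iUnion {ι : Sort*} (T : ι → Set (Tile d P)) :
    S.subst (⋃ i, T i) = ⋃ i, S.subst (T i) := by
  ext t
  simp only [mem_subst, Set.mem_iUnion]
  grind

theorem mem_subst_iterate {n : ℕ} {T : Set (Tile d P)} {t : Tile d P} :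
    t ∈ S.subst^[n] T ↔ ∃ s ∈ T, t ∈ S.subst^[n] {s} := by
  induction n generalizing t with
  | zero => simp
  | succ n ih =>
    simp only [Function.iterate_succ_apply', mem_subst]
    constructor
    · rintro ⟨s, hs, h⟩
      obtain ⟨r, hr, hs⟩ := ih.1 hs
      exact ⟨r, hr, s, hs, h⟩
    · rintro ⟨r, hr, s, hs, h⟩
      exact ⟨s, ih.2 ⟨r, hr, hs⟩, h⟩

theorem subst_translate (T : Set (Tile d P)) (x : EuclideanSpace ℝ (Fin d)) :
    S.subst (translateTiles T x) = translateTiles (S.subst T) (S.scale • x) := by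
  ext t
  simp only [mem_subst, mem_translateTiles]
  constructor
  · rintro ⟨s, hs, h⟩
    refine ⟨_, hs, ?_⟩
    convert h using 2
    simp only [smul_sub]
    abel
  · rintro ⟨s, hs, h⟩
    refine ⟨(s.1, s.2 + x), by simpa using hs, ?_⟩
    convert h using 2
    simp only [smul_add]
    abel

theorem subst_iterate_translate (n : ℕ) (T : Set (Tile d P)) (x : EuclideanSpace ℝ (Fin d)) :
    S.subst^[n] (translateTiles T x) = translateTiles (S.subst^[n] T) (S.scale ^ n • x) := by
  induction n generalizing T x with
  | zero => simp
  | succ n ih => rw [Function.iterate_succ_apply, subst_translate, ih, smul_smul, pow_succ,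
      Function.iterate_succ_apply]

theorem mem_setSupp_subst {T : Set (Tile d P)} {y : EuclideanSpace ℝ (Fin d)} :
    y ∈ S.setSupp (S.subst T) ↔ S.scale⁻¹ • y ∈ S.setSupp T := by
  have key : ∀ s : Tile d P, y ∈ S.setSupp (translateTiles (S.sub s.1) (S.scale • s.2)) ↔
      S.scale⁻¹ • y ∈ S.tileSupp s := by
    intro s
    rw [Prototiles.mem_setSupp_translate, S.setSupp_sub, Prototiles.mem_tileSupp]
    constructor
    · rintro ⟨z, hz, h⟩
      have : y = S.scale • (z + s.2) := by
        rw [smul_add]; exact (eq_add_of_sub_eq (by simpa using h.symm))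
      rw [this, inv_smul_smul₀ S.scale_ne_zero]
      simpa using hz
    · intro h
      refine ⟨_, h, ?_⟩
      simp only [smul_sub, smul_inv_smul₀ S.scale_ne_zero]
  rw [S.mem_setSupp (Q := T)]
  simp only [← key]
  simp only [Prototiles.mem_setSupp, subst, Set.mem_iUnion]
  constructor
  · rintro ⟨t, ⟨s, hs, h⟩, hy⟩
    exact ⟨s, hs, t, h, hy⟩
  · rintro ⟨s, hs, t, h, hy⟩
    exact ⟨t, ⟨s, hs, h⟩, hy⟩

theorem mem_setSupp_subst_iterate (n : ℕ) {T : Set (Tile d P)} {y : EuclideanSpace ℝ (Fin d)} :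
    y ∈ S.setSupp (S.subst^[n] T) ↔ (S.scale ^ n)⁻¹ • y ∈ S.setSupp T := by
  induction n generalizing y with
  | zero => simp
  | succ n ih => rw [Function.iterate_succ_apply', mem_setSupp_subst, ih, smul_smul, pow_succ,
      mul_inv]

theorem smul_mem_tileSupp_of_mem_subst_iterate {n : ℕ} {s t : Tile d P}
    (h : t ∈ S.subst^[n] {s}) {y : EuclideanSpace ℝ (Fin d)} (hy : y ∈ S.tileSupp t) :
    (S.scale ^ n)⁻¹ • y ∈ S.tileSupp s := by
  rw [← Prototiles.setSupp_singleton, ← mem_setSupp_subst_iterate]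
  exact S.mem_setSupp.2 ⟨t, h, hy⟩

theorem smul_mem_interior_of_mem_subst_iterate {n : ℕ} {s t : Tile d P}
    (h : t ∈ S.subst^[n] {s}) {y : EuclideanSpace ℝ (Fin d)}
    (hy : y ∈ interior (S.tileSupp t)) : (S.scale ^ n)⁻¹ • y ∈ interior (S.tileSupp s) := by
  have h0 : (S.scale ^ n)⁻¹ ≠ 0 := inv_ne_zero (pow_ne_zero _ S.scale_ne_zero)
  have := (Homeomorph.smulOfNeZero (α := EuclideanSpace ℝ (Fin d)) _ h0).preimage_interior
    (S.tileSupp s)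
  change y ∈ Homeomorph.smulOfNeZero (α := EuclideanSpace ℝ (Fin d)) _ h0 ⁻¹'
    interior (S.tileSupp s)
  rw [this]
  exact interior_mono (fun z hz => S.smul_mem_tileSupp_of_mem_subst_iterate h hz) hy

/-- Ancestors are unique: the rescaled puncture of `t` is interior to `s` and lies in `s'`. -/
theorem eq_of_mem_subst_iterate {T : Set (Tile d P)} (hT : S.NonOverlapping T) {n : ℕ}
    {s s' t : Tile d P} (hs : s ∈ T) (hs' : s' ∈ T) (h : t ∈ S.subst^[n] {s})
    (h' : t ∈ S.subst^[n] {s'}) : s = s' :=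
  hT.eq_of_mem hs hs' (S.smul_mem_interior_of_mem_subst_iterate h (S.tilePuncture_mem_interior t))
    (S.smul_mem_tileSupp_of_mem_subst_iterate h' (S.tilePuncture_mem t))

theorem adjacent_of_mem_subst_iterate {n : ℕ} {s s' t t' : Tile d P} (h : t ∈ S.subst^[n] {s})
    (h' : t' ∈ S.subst^[n] {s'}) (htt' : S.Adjacent t t') : S.Adjacent s s' := by
  obtain ⟨y, hy, hy'⟩ := htt'
  exact ⟨_, S.smul_mem_tileSupp_of_mem_subst_iterate h hy,
    S.smul_mem_tileSupp_of_mem_subst_iterate h' hy'⟩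

theorem nonOverlapping_subst {T : Set (Tile d P)} (hT : S.NonOverlapping T) :
    S.NonOverlapping (S.subst T) := by
  intro t ht t' ht' hne
  simp only [subst, Set.mem_iUnion, exists_prop] at ht ht'
  obtain ⟨s, hs, h⟩ := ht
  obtain ⟨s', hs', h'⟩ := ht'
  by_cases hss : s = s'
  · subst hss
    exact ((S.isPatch_sub s.1).2.1.translate _) t h t' h' hne
  · refine Set.disjoint_left.2 fun y hy hy' => ?_
    have e : t ∈ S.subst^[1] {s} := by simpa [subst] using h
    have e' : t' ∈ S.subst^[1] {s'} := by simpa [subst] using h'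
    exact Set.disjoint_left.1 (hT s hs s' hs' hss)
      (S.smul_mem_interior_of_mem_subst_iterate e hy)
      (S.smul_mem_interior_of_mem_subst_iterate e' hy')

theorem isTiling_subst {T : Set (Tile d P)} (hT : S.IsTiling T) : S.IsTiling (S.subst T) := by
  refine ⟨Set.eq_univ_of_forall fun y => ?_, S.nonOverlapping_subst hT.2⟩
  rw [mem_setSupp_subst, hT.1]
  trivial

theorem translate_mem_hull {T : Set (Tile d P)} (hT : T ∈ S.hull)
    (x : EuclideanSpace ℝ (Fin d)) : translateTiles T x ∈ S.hull := by
  refine ⟨hT.1.translate x, fun Q hQ hf => ?_⟩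
  have hQ' : translateTiles Q (-x) ⊆ T := by
    rw [translateTiles_subset_iff, neg_neg]
    exact hQ
  obtain ⟨n, p, y, h⟩ := hT.2 _ hQ' (hf.image _)
  refine ⟨n, p, y + x, ?_⟩
  rw [← translateTiles_translateTiles]
  rw [translateTiles_subset_iff, neg_neg] at h
  exact h

theorem subst_mem_hull {T : Set (Tile d P)} (hT : T ∈ S.hull) : S.subst T ∈ S.hull := by
  refine ⟨S.isTiling_subst hT.1, fun Q hQ hf => ?_⟩
  -- The parents of the tiles of `Q` form a finite subset of `T`, hence lie in a supertile, whose
  -- substitution is a supertile of the next level.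
  have : ∀ t : Tile d P, ∃ s, t ∈ Q → s ∈ T ∧ t ∈ S.subst {s} := by
    intro t
    by_cases ht : t ∈ Q
    · obtain ⟨s, hs, h⟩ := S.mem_subst.1 (hQ ht)
      exact ⟨s, fun _ => ⟨hs, S.mem_subst.2 ⟨s, rfl, h⟩⟩⟩
    · exact ⟨t, fun h => absurd h ht⟩
  choose f hf' using this
  obtain ⟨n, p, x, h⟩ := hT.2 (f '' Q) (by rintro _ ⟨t, ht, rfl⟩; exact (hf' t ht).1) (hf.image f)
  refine ⟨n + 1, p, S.scale • x, fun t ht => ?_⟩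
  rw [supertile, Function.iterate_succ_apply', ← subst_translate]
  exact S.subst_mono (Set.singleton_subset_iff.2 (h ⟨t, ht, rfl⟩)) (hf' t ht).2

theorem subst_iterate_mem_hull {T : Set (Tile d P)} (hT : T ∈ S.hull) (n : ℕ) :
    S.subst^[n] T ∈ S.hull := by
  induction n with
  | zero => exact hT
  | succ n ih =>
    rw [Function.iterate_succ_apply']
    exact S.subst_mem_hull ih

end TileSubstitution

/-! ### Uniform size of tiles and local finiteness -/

namespace Prototiles

variable {d : ℕ} {P : Type*} (A : Prototiles d P)

theorem exists_forall_ball_subset_tileSupp [Finite P] :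
    ∃ r > 0, ∀ t : Tile d P, Metric.ball (A.tilePuncture t) r ⊆ A.tileSupp t := by
  have h : ∀ᶠ r : ℝ in nhdsWithin 0 (Set.Ioi 0), ∀ p : P,
      Metric.ball (A.puncture p) r ⊆ A.supp p := by
    refine Filter.eventually_all.2 fun p => ?_
    obtain ⟨r, hr, h⟩ := Metric.isOpen_iff.1 isOpen_interior _ (A.puncture_mem p)
    filter_upwards [Ioo_mem_nhdsGT hr] with e he
    exact (Metric.ball_subset_ball he.2.le).trans (h.trans interior_subset)
  obtain ⟨r, h, hr⟩ := (h.and self_mem_nhdsWithin).exists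
  refine ⟨r, hr, fun t y hy => ?_⟩
  rw [mem_tileSupp]
  apply h
  rw [Metric.mem_ball, dist_eq_norm] at hy ⊢
  rwa [sub_right_comm, sub_sub, ← tilePuncture]

theorem exists_forall_dist_tilePuncture_le [Finite P] :
    ∃ R, ∀ t : Tile d P, ∀ y ∈ A.tileSupp t, dist y (A.tilePuncture t) ≤ R := by
  have h : ∀ᶠ R : ℝ in Filter.atTop, ∀ p : P, A.supp p ⊆ Metric.closedBall (A.puncture p) R := by
    refine Filter.eventually_all.2 fun p => ?_
    obtain ⟨R, hR⟩ := (A.isCompact_supp p).isBounded.subset_closedBall (A.puncture p)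
    filter_upwards [Filter.eventually_ge_atTop R] with e he
    exact hR.trans (Metric.closedBall_subset_closedBall he)
  obtain ⟨R, h⟩ := h.exists
  refine ⟨R, fun t y hy => ?_⟩
  have := h t.1 (A.mem_tileSupp.1 hy)
  rw [Metric.mem_closedBall, dist_eq_norm] at this
  rwa [dist_eq_norm, tilePuncture, add_comm, ← sub_sub]

variable {A}

/-- Tiles meeting `B` have punctures in a bounded set, and punctures of distinct tiles are at least
`r` apart, so total boundedness applies. -/
theorem NonOverlapping.finite_of_isBounded [Finite P] {T : Set (Tile d P)}
    (h : A.NonOverlapping T) {B : Set (EuclideanSpace ℝ (Fin d))} (hB : Bornology.IsBounded B) :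
    {t ∈ T | (A.tileSupp t ∩ B).Nonempty}.Finite := by
  obtain ⟨r, hr, hball⟩ := A.exists_forall_ball_subset_tileSupp
  obtain ⟨R, hR⟩ := A.exists_forall_dist_tilePuncture_le
  have hb : Bornology.IsBounded (Metric.cthickening R B) := hB.cthickening
  obtain ⟨C, hC, hcov⟩ := Metric.totallyBounded_iff.1
    (hb.isCompact_closure.totallyBounded.subset subset_closure) (r / 2) (half_pos hr)
  have hex : ∀ t ∈ {t ∈ T | (A.tileSupp t ∩ B).Nonempty},
      ∃ c ∈ C, dist (A.tilePuncture t) c < r / 2 := by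
    rintro t ⟨ht, y, hy, hyB⟩
    have := hcov (Metric.mem_cthickening_of_dist_le _ y R B hyB
      (by rw [dist_comm]; exact hR t y hy))
    simpa using this
  choose! f hf hd using hex
  -- Two tiles assigned to the same centre have punctures closer than `r`, so the puncture of one
  -- lies in the other.
  refine Set.Finite.of_injOn (f := f) hf (fun t ht u hu htu => ?_) hC
  refine h.eq_of_mem ht.1 hu.1 (A.tilePuncture_mem_interior t) (hball u ?_)
  have h1 := hd t ht
  have h2 := hd u hu
  rw [← htu, dist_comm] at h2
  exact (dist_triangle _ _ _).trans_lt (by linarith)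

theorem NonOverlapping.isClosed_setSupp [Finite P] {T : Set (Tile d P)}
    (h : A.NonOverlapping T) : IsClosed (A.setSupp T) := by
  have : A.setSupp T = ⋃ t : T, A.tileSupp t := by simp [setSupp]
  rw [this]
  refine LocallyFinite.isClosed_iUnion (fun x => ⟨Metric.ball x 1, Metric.ball_mem_nhds x one_pos, ?_⟩)
    fun t => (A.isCompact_tileSupp t).isClosed
  refine Set.Finite.of_finite_image (f := Subtype.val) ?_ Subtype.val_injective.injOn
  refine (h.finite_of_isBounded (Metric.isBounded_ball (x := x) (r := 1))).subset ?_
  rintro _ ⟨t, ht, rfl⟩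
  exact ⟨t.2, ht⟩

end Prototiles

/-! ### Coronas and border forcing -/

namespace TileSubstitution

variable {d : ℕ} {P : Type*} (S : TileSubstitution d P)

theorem corona_subset (T Q : Set (Tile d P)) : S.corona T Q ⊆ T := fun _ h => h.1

theorem corona_translate (T Q : Set (Tile d P)) (x : EuclideanSpace ℝ (Fin d)) :
    S.corona (translateTiles T x) (translateTiles Q x) = translateTiles (S.corona T Q) x := by
  ext t
  rw [mem_translateTiles]
  simp only [corona, Set.mem_ofPred_eq, mem_translateTiles]
  refine and_congr_right fun _ => ?_
  have e : t = ((t.1, t.2 - x).1, (t.1, t.2 - x).2 + x) := by simp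
  constructor
  · rintro ⟨y, hy, hy'⟩
    rw [e, Prototiles.mem_tileSupp_translate] at hy
    exact ⟨y - x, hy, S.mem_setSupp_translate.1 hy'⟩
  · rintro ⟨y, hy, hy'⟩
    refine ⟨y + x, ?_, S.mem_setSupp_translate.2 (by simpa)⟩
    rw [e, Prototiles.mem_tileSupp_translate]
    simpa using hy

/-- By local finiteness the tiles outside the corona cover a closed set; it misses the compact
support of `Q` and so stays at positive distance from it. -/
theorem exists_thickening_subset_corona [Finite P] {T Q : Set (Tile d P)} (hT : S.IsTiling T)
    (hQ : IsCompact (S.setSupp Q)) :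
    ∃ e > 0, Metric.thickening e (S.setSupp Q) ⊆ S.setSupp (S.corona T Q) := by
  have hc : IsClosed (S.setSupp (T \ S.corona T Q)) :=
    (hT.2.mono Set.sdiff_subset).isClosed_setSupp
  obtain ⟨e, he, h⟩ := hQ.exists_thickening_subset_open hc.isOpen_compl (by
    intro y hy hy'
    obtain ⟨t, ht, hyt⟩ := S.mem_setSupp.1 hy'
    exact ht.2 ⟨ht.1, y, hyt, hy⟩)
  refine ⟨e, he, fun y hy => ?_⟩
  obtain ⟨t, ht, hyt⟩ := S.mem_setSupp.1 (hT.1.symm ▸ Set.mem_univ y)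
  refine S.mem_setSupp.2 ⟨t, ?_, hyt⟩
  by_contra hn
  exact h hy (S.mem_setSupp.2 ⟨t, ⟨ht, hn⟩, hyt⟩)

/-- Every `k`-supertile is admitted, and a tile of an admitted tiling determines the corona of its
`k`-th inflation. -/
def ForcesBorderAt (k : ℕ) : Prop :=
  (∀ p : P, ∃ T ∈ S.hull, S.supertile k p ⊆ T) ∧
    ∀ T ∈ S.hull, ∀ T' ∈ S.hull, ∀ s ∈ T, s ∈ T' →
      S.corona (S.subst^[k] T) (S.subst^[k] {s}) = S.corona (S.subst^[k] T') (S.subst^[k] {s})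

variable {S}

theorem ForcesBorder.exists_forcesBorderAt (h : S.ForcesBorder) : ∃ k, S.ForcesBorderAt k := by
  obtain ⟨k, h⟩ := h
  refine ⟨k, fun p => (h p).1, fun T hT T' hT' s hs hs' => ?_⟩
  have key : ∀ U : Set (Tile d P), S.corona (S.subst^[k] U) (S.subst^[k] {s}) =
      translateTiles (S.corona (S.subst^[k] (translateTiles U (-s.2))) (S.supertile k s.1))
        (S.scale ^ k • s.2) := by
    intro U
    rw [← corona_translate, supertile, ← subst_iterate_translate, ← subst_iterate_translate,
      translateTiles_neg_add_cancel, translateTiles_singleton, zero_add]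
  rw [key, key, (h s.1).2 _ (S.translate_mem_hull hT _) _ (S.translate_mem_hull hT' _)]
  · exact mem_translateTiles.2 (by simpa)
  · exact mem_translateTiles.2 (by simpa)

theorem isCompact_setSupp_subst_iterate (n : ℕ) (s : Tile d P) :
    IsCompact (S.setSupp (S.subst^[n] {s})) := by
  have : S.setSupp (S.subst^[n] {s}) = (fun y => S.scale ^ n • y) '' S.tileSupp s := by
    ext y
    have h0 := pow_ne_zero n S.scale_ne_zero
    rw [mem_setSupp_subst_iterate, Prototiles.setSupp_singleton]
    constructor
    · intro h
      exact ⟨_, h, by simp only [smul_inv_smul₀ h0]⟩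
    · rintro ⟨z, hz, rfl⟩
      simpa only [inv_smul_smul₀ h0] using hz
  rw [this]
  exact (S.isCompact_tileSupp s).image (by fun_prop)

/-- Border forcing makes the corona depend only on the tile, hence up to translation on its label,
and there are finitely many labels. -/
theorem ForcesBorderAt.exists_forall_thickening_subset [Finite P] {k : ℕ}
    (h : S.ForcesBorderAt k) : ∃ e > 0, ∀ T ∈ S.hull, ∀ s ∈ T,
      Metric.thickening e (S.setSupp (S.subst^[k] {s})) ⊆
        S.setSupp (S.corona (S.subst^[k] T) (S.subst^[k] {s})) := by
  have hp : ∀ᶠ e : ℝ in nhdsWithin 0 (Set.Ioi 0), ∀ p : P, ∀ T ∈ S.hull, (p, 0) ∈ T →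
      Metric.thickening e (S.setSupp (S.subst^[k] {(p, 0)})) ⊆
        S.setSupp (S.corona (S.subst^[k] T) (S.subst^[k] {(p, 0)})) := by
    refine Filter.eventually_all.2 fun p => ?_
    by_cases hex : ∃ T ∈ S.hull, (p, 0) ∈ T
    · obtain ⟨T, hT, hpT⟩ := hex
      obtain ⟨e, he, hsub⟩ := S.exists_thickening_subset_corona
        (S.subst_iterate_mem_hull hT k).1 (isCompact_setSupp_subst_iterate k (p, 0))
      filter_upwards [Ioo_mem_nhdsGT he] with e' he' T' hT' hpT'
      rw [h.2 T' hT' T hT _ hpT' hpT]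
      exact (Metric.thickening_mono he'.2.le _).trans hsub
    · exact Filter.Eventually.of_forall fun e T hT hpT => absurd ⟨T, hT, hpT⟩ hex
  obtain ⟨e, hp, he⟩ := (hp.and self_mem_nhdsWithin).exists
  refine ⟨e, he, fun T hT s hs => ?_⟩
  have hs' := hp s.1 (translateTiles T (-s.2)) (S.translate_mem_hull hT _)
    (mem_translateTiles.2 (by simpa))
  have e1 : ({s} : Set (Tile d P)) = translateTiles {(s.1, 0)} s.2 := by
    rw [translateTiles_singleton, zero_add]
  have e2 : T = translateTiles (translateTiles T (-s.2)) s.2 := by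
    rw [translateTiles_neg_add_cancel]
  generalize translateTiles T (-s.2) = U at hs' e2
  intro y hy
  rw [e2, e1, subst_iterate_translate, subst_iterate_translate, corona_translate,
    Prototiles.mem_setSupp_translate]
  apply hs'
  rw [Metric.mem_thickening_iff] at hy ⊢
  obtain ⟨z, hz, hyz⟩ := hy
  rw [e1, subst_iterate_translate, Prototiles.mem_setSupp_translate] at hz
  exact ⟨_, hz, by simpa using hyz⟩

/-- Tiles of an admitted tiling that are close enough are adjacent. -/
theorem ForcesBorder.exists_forall_adjacent [Finite P] (h : S.ForcesBorder) :
    ∃ e > 0, ∀ T ∈ S.hull, ∀ s ∈ T, ∀ t ∈ T, ∀ x ∈ S.tileSupp s, ∀ y ∈ S.tileSupp t,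
      dist x y < e → S.Adjacent s t := by
  obtain ⟨k, h⟩ := h.exists_forcesBorderAt
  obtain ⟨e, he, hcor⟩ := h.exists_forall_thickening_subset
  have hk : 0 < S.scale ^ k := pow_pos S.scale_pos k
  refine ⟨e / S.scale ^ k, div_pos he hk, fun T hT s hs t ht x hx y hy hxy => ?_⟩
  -- Passing to an interior point `z` of `t` ensures that a corona tile over λᵏ `z` can only descend
  -- from `t`. That tile touches the supertile of `s`, and scaling the contact point down gives a
  -- common point of `s` and `t`.
  rw [← S.closure_interior_tileSupp] at hy
  obtain ⟨z, hz, hyz⟩ := Metric.mem_closure_iff.1 hy (e / S.scale ^ k - dist x y) (by linarith)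
  have hxz : dist x z < e / S.scale ^ k := (dist_triangle x y z).trans_lt (by linarith)
  have hz' : S.scale ^ k • z ∈ S.setSupp (S.corona (S.subst^[k] T) (S.subst^[k] {s})) := by
    refine hcor T hT s hs (Metric.mem_thickening_iff.2 ⟨S.scale ^ k • x, ?_, ?_⟩)
    · rw [mem_setSupp_subst_iterate, inv_smul_smul₀ hk.ne', Prototiles.setSupp_singleton]
      exact hx
    · rw [dist_smul₀, Real.norm_of_nonneg hk.le, dist_comm]
      rwa [lt_div_iff₀' hk] at hxz
  obtain ⟨u, ⟨huT, v, hvu, hvs⟩, hzu⟩ := S.mem_setSupp.1 hz'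
  obtain ⟨t', ht', hut'⟩ := S.mem_subst_iterate.1 huT
  have h1 := S.smul_mem_tileSupp_of_mem_subst_iterate hut' hzu
  rw [inv_smul_smul₀ hk.ne'] at h1
  obtain rfl : t = t' := hT.1.2.eq_of_mem ht ht' hz h1
  rw [mem_setSupp_subst_iterate, Prototiles.setSupp_singleton] at hvs
  exact ⟨_, hvs, S.smul_mem_tileSupp_of_mem_subst_iterate hut' hvu⟩

end TileSubstitution

/-! ### Ancestor sequences and the coding of tilings by paths -/

namespace TileSubstitution

variable {d : ℕ} {P : Type*} (S : TileSubstitution d P)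

theorem exists_mem_subst_singleton {T : Set (Tile d P)} {t : Tile d P} (h : t ∈ S.subst T) :
    ∃ s ∈ T, t ∈ S.subst {s} :=
  (S.mem_subst_iterate (n := 1)).1 h

theorem mem_subst_iterate_of_forall_mem {t : ℕ → Tile d P}
    (h : ∀ n, t n ∈ S.subst {t (n + 1)}) (n m : ℕ) : t n ∈ S.subst^[m] {t (n + m)} := by
  induction m with
  | zero => simp
  | succ m ih =>
    rw [Function.iterate_succ_apply]
    exact S.subst_iterate_mono m (Set.singleton_subset_iff.2 (h (n + m))) ih

/-! ### Hierarchies of tilings -/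

/-- A sequence of admitted tilings, each of which is the substitution of the next. -/
def IsHierarchy (H : ℕ → Set (Tile d P)) : Prop :=
  ∀ n, H n ∈ S.hull ∧ S.subst (H (n + 1)) = H n

variable {S}

theorem IsHierarchy.translate {H : ℕ → Set (Tile d P)} (h : S.IsHierarchy H)
    (x : EuclideanSpace ℝ (Fin d)) :
    S.IsHierarchy fun n => translateTiles (H n) ((S.scale ^ n)⁻¹ • x) := by
  refine fun n => ⟨S.translate_mem_hull (h n).1 _, ?_⟩
  rw [subst_translate, (h n).2, smul_smul, pow_succ, mul_inv, mul_left_comm,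
    mul_inv_cancel₀ S.scale_ne_zero, mul_one]

theorem IsHierarchy.drop {H : ℕ → Set (Tile d P)} (h : S.IsHierarchy H) (k : ℕ) :
    S.IsHierarchy fun n => H (n + k) := fun n =>
  ⟨(h _).1, by
    have := (h (n + k)).2
    rwa [← Nat.add_right_comm] at this⟩

theorem IsHierarchy.subst_iterate {H : ℕ → Set (Tile d P)} (h : S.IsHierarchy H) (n m : ℕ) :
    S.subst^[m] (H (n + m)) = H n := by
  induction m with
  | zero => rfl
  | succ m ih =>
    rw [Function.iterate_succ_apply, ← add_assoc, (h _).2, ih]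

theorem IsHierarchy.eq_of_zero_eq (hrec : S.Recognisable) {H H' : ℕ → Set (Tile d P)}
    (h : S.IsHierarchy H) (h' : S.IsHierarchy H') (h0 : H 0 = H' 0) : H = H' := by
  funext n
  induction n with
  | zero => exact h0
  | succ n ih =>
    refine hrec (h _).1 (h' _).1 ?_
    rw [(h n).2, (h' n).2, ih]

theorem IsHierarchy.exists_seq {H : ℕ → Set (Tile d P)} (h : S.IsHierarchy H) {b : Tile d P}
    (hb : b ∈ H 0) :
    ∃ t : ℕ → Tile d P, t 0 = b ∧ (∀ n, t n ∈ H n) ∧ ∀ n, t n ∈ S.subst {t (n + 1)} := by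
  have hpar : ∀ n, ∀ t ∈ H n, ∃ s ∈ H (n + 1), t ∈ S.subst {s} := fun n t ht =>
    S.exists_mem_subst_singleton ((h n).2.symm ▸ ht)
  choose! f hf hf' using hpar
  have hmem : ∀ n, (Nat.rec b f n : Tile d P) ∈ H n := by
    intro n
    induction n with
    | zero => exact hb
    | succ n ih => exact hf n _ ih
  exact ⟨fun n => Nat.rec b f n, rfl, hmem, fun n => hf' n _ (hmem n)⟩

/-! ### The limit of the coronas of a sequence of growing supertiles -/

section Limit

variable (S)

/-- The tiling that is filled by the coronas of the `k`-th inflations of the tiles `t j ∈ A j`. -/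
def coronaLimit (k : ℕ) (A : ℕ → Set (Tile d P)) (t : ℕ → Tile d P) (j : ℕ) : Set (Tile d P) :=
  ⋃ m, S.subst^[m] (S.corona (S.subst^[k] (A (j + m))) (S.subst^[k] {t (j + m)}))

variable {S} {k : ℕ} {A : ℕ → Set (Tile d P)} {t : ℕ → Tile d P}

/-- The tilings `A j` need not be related to each other. Border forcing allows `A j` to be replaced
by φ(`A (j + 1)`), which also contains `t j`; then a tile touching the smaller supertile has a
parent touching the larger one. -/
theorem ForcesBorderAt.corona_subset_subst (hb : S.ForcesBorderAt k) (hA : ∀ n, A n ∈ S.hull)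
    (ht : ∀ n, t n ∈ A n) (hsub : ∀ n, t n ∈ S.subst {t (n + 1)}) (j : ℕ) :
    S.corona (S.subst^[k] (A j)) (S.subst^[k] {t j}) ⊆
      S.subst (S.corona (S.subst^[k] (A (j + 1))) (S.subst^[k] {t (j + 1)})) := by
  rw [hb.2 _ (hA j) _ (S.subst_mem_hull (hA (j + 1))) _ (ht j)
    (S.subst_mono (Set.singleton_subset_iff.2 (ht (j + 1))) (hsub j))]
  rintro u ⟨hu, y, hyu, hy⟩
  rw [← Function.iterate_succ_apply, Function.iterate_succ_apply'] at hu
  obtain ⟨v, hv, huv⟩ := S.exists_mem_subst_singleton hu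
  suffices hv' : v ∈ S.corona (S.subst^[k] (A (j + 1))) (S.subst^[k] {t (j + 1)}) from
    S.subst_mono (Set.singleton_subset_iff.2 hv') huv
  refine ⟨hv, S.scale⁻¹ • y, ?_, ?_⟩
  · have := S.smul_mem_tileSupp_of_mem_subst_iterate (n := 1) huv hyu
    rwa [pow_one] at this
  · rw [← S.mem_setSupp_subst, ← Function.iterate_succ_apply' S.subst, Function.iterate_succ_apply]
    exact S.setSupp_mono (S.subst_iterate_mono k (Set.singleton_subset_iff.2 (hsub j))) hy

theorem ForcesBorderAt.monotone_subst_corona (hb : S.ForcesBorderAt k) (hA : ∀ n, A n ∈ S.hull)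
    (ht : ∀ n, t n ∈ A n) (hsub : ∀ n, t n ∈ S.subst {t (n + 1)}) (j : ℕ) :
    Monotone fun m =>
      S.subst^[m] (S.corona (S.subst^[k] (A (j + m))) (S.subst^[k] {t (j + m)})) := by
  refine monotone_nat_of_le_succ fun m => ?_
  rw [Function.iterate_succ_apply]
  exact S.subst_iterate_mono m (hb.corona_subset_subst hA ht hsub (j + m))

theorem ForcesBorderAt.subst_coronaLimit (hb : S.ForcesBorderAt k) (hA : ∀ n, A n ∈ S.hull)
    (ht : ∀ n, t n ∈ A n) (hsub : ∀ n, t n ∈ S.subst {t (n + 1)}) (j : ℕ) :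
    S.subst (S.coronaLimit k A t (j + 1)) = S.coronaLimit k A t j := by
  rw [coronaLimit, subst_iUnion, coronaLimit]
  simp only [← Function.iterate_succ_apply' S.subst, Nat.add_right_comm j 1]
  refine Set.Subset.antisymm (Set.iUnion_subset fun m => ?_) (Set.iUnion_subset fun m => ?_)
  · exact Set.subset_iUnion (fun m =>
      S.subst^[m] (S.corona (S.subst^[k] (A (j + m))) (S.subst^[k] {t (j + m)}))) (m + 1)
  · refine (hb.monotone_subst_corona hA ht hsub j m.le_succ).trans ?_
    exact Set.subset_iUnion (fun m => S.subst^[m + 1]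
      (S.corona (S.subst^[k] (A (j + m + 1))) (S.subst^[k] {t (j + m + 1)}))) m

theorem ForcesBorderAt.exists_hull_of_finite_subset (hb : S.ForcesBorderAt k)
    (hA : ∀ n, A n ∈ S.hull) (ht : ∀ n, t n ∈ A n) (hsub : ∀ n, t n ∈ S.subst {t (n + 1)})
    (j : ℕ) {Q : Set (Tile d P)} (hQ : Q.Finite) (hQs : Q ⊆ S.coronaLimit k A t j) :
    ∃ T ∈ S.hull, Q ⊆ T := by
  have hmono := hb.monotone_subst_corona hA ht hsub j
  -- The stages increase, so a finite set of tiles is contained in a single one.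
  have : ∃ m, Q ⊆ S.subst^[m] (S.corona (S.subst^[k] (A (j + m))) (S.subst^[k] {t (j + m)})) := by
    induction Q, hQ using Set.Finite.induction_on with
    | empty => exact ⟨0, Set.empty_subset _⟩
    | @insert a Q _ _ ih =>
      obtain ⟨m, hm⟩ := ih ((Set.subset_insert _ _).trans hQs)
      obtain ⟨m', hm'⟩ := Set.mem_iUnion.1 (hQs (Set.mem_insert _ _))
      exact ⟨max m m', Set.insert_subset (hmono (le_max_right m m') hm')
        (hm.trans (hmono (le_max_left m m')))⟩
  obtain ⟨m, hm⟩ := this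
  exact ⟨_, S.subst_iterate_mem_hull (S.subst_iterate_mem_hull (hA (j + m)) k) m,
    hm.trans (S.subst_iterate_mono m (S.corona_subset _ _))⟩

theorem ForcesBorderAt.coronaLimit_mem_hull [Finite P] (hb : S.ForcesBorderAt k)
    (hA : ∀ n, A n ∈ S.hull) (ht : ∀ n, t n ∈ A n) (hsub : ∀ n, t n ∈ S.subst {t (n + 1)})
    (j : ℕ) : S.coronaLimit k A t j ∈ S.hull := by
  refine ⟨⟨Set.eq_univ_of_forall fun y => ?_, fun u hu v hv huv => ?_⟩, fun Q hQ hf => ?_⟩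
  · obtain ⟨e, he, hcor⟩ := hb.exists_forall_thickening_subset
    -- The point `x` belongs to every stage. Scaled down by λᵐ, `y` comes within `e` of the image of
    -- `x` in the `k`-supertile of `t (j + m)`, hence into its corona.
    set x := S.scale ^ k • S.tilePuncture (t j) with hx
    obtain ⟨m, hm⟩ := pow_unbounded_of_one_lt (dist y x / e) S.one_lt_scale
    have hm0 : 0 < S.scale ^ m := pow_pos S.scale_pos m
    have hk0 : S.scale ^ k ≠ 0 := pow_ne_zero k S.scale_ne_zero
    have hmem : (S.scale ^ m)⁻¹ • y ∈
        S.setSupp (S.corona (S.subst^[k] (A (j + m))) (S.subst^[k] {t (j + m)})) := by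
      refine hcor _ (hA _) _ (ht _) (Metric.mem_thickening_iff.2 ⟨(S.scale ^ m)⁻¹ • x, ?_, ?_⟩)
      · rw [mem_setSupp_subst_iterate, Prototiles.setSupp_singleton, hx, smul_comm,
          inv_smul_smul₀ hk0]
        exact S.smul_mem_tileSupp_of_mem_subst_iterate
          (S.mem_subst_iterate_of_forall_mem hsub j m) (S.tilePuncture_mem _)
      · rw [dist_smul₀, norm_inv, Real.norm_of_nonneg hm0.le, inv_mul_lt_iff₀ hm0]
        rwa [div_lt_iff₀ he] at hm
    rw [← mem_setSupp_subst_iterate] at hmem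
    exact S.setSupp_mono (Set.subset_iUnion (fun m => S.subst^[m]
      (S.corona (S.subst^[k] (A (j + m))) (S.subst^[k] {t (j + m)}))) m) hmem
  · obtain ⟨T, hT, hsubT⟩ := hb.exists_hull_of_finite_subset hA ht hsub j (Set.toFinite {u, v})
      (Set.insert_subset hu (Set.singleton_subset_iff.2 hv))
    exact hT.1.2 u (hsubT (by simp)) v (hsubT (by simp)) huv
  · obtain ⟨T, hT, hsubT⟩ := hb.exists_hull_of_finite_subset hA ht hsub j hf hQ
    exact hT.2 Q hsubT hf

/-- The limit at index `j` is built from `k`-fold inflations of level-`j` tiles, so index `n + k`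
corresponds to level `n` of the hierarchy. -/
theorem mem_coronaLimit (ht : ∀ n, t n ∈ A n)
    (hsub : ∀ n, t n ∈ S.subst {t (n + 1)}) (n : ℕ) : t n ∈ S.coronaLimit k A t (n + k) := by
  refine Set.mem_iUnion.2 ⟨0, ?_⟩
  have h := S.mem_subst_iterate_of_forall_mem hsub n k
  exact ⟨S.subst_iterate_mono k (Set.singleton_subset_iff.2 (ht _)) h, S.tilePuncture (t n),
    S.tilePuncture_mem _, S.mem_setSupp.2 ⟨_, h, S.tilePuncture_mem _⟩⟩

/-- Border forcing lets `A` be exchanged for `H` in each corona, so the limit is contained in `H n`;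
a tiling inside a non-overlapping set is all of it. -/
theorem ForcesBorderAt.eq_coronaLimit [Finite P] (hb : S.ForcesBorderAt k)
    (hA : ∀ n, A n ∈ S.hull) (ht : ∀ n, t n ∈ A n) (hsub : ∀ n, t n ∈ S.subst {t (n + 1)})
    {H : ℕ → Set (Tile d P)} (hH : S.IsHierarchy H) (htH : ∀ n, t n ∈ H n) (n : ℕ) :
    H n = S.coronaLimit k A t (n + k) := by
  refine ((hb.coronaLimit_mem_hull hA ht hsub (n + k)).1.eq_of_subset (hH n).1.1.2
    (Set.iUnion_subset fun m => ?_)).symm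
  rw [hb.2 _ (hA _) _ (hH (n + k + m)).1 _ (ht _) (htH _)]
  refine (S.subst_iterate_mono m (S.corona_subset _ _)).trans ?_
  rw [← Function.iterate_add_apply, add_assoc, add_comm k m, hH.subst_iterate]

end Limit

/-! ### Paths and sequences of tiles -/

variable (S) in
/-- The edges of the path `w` are the extensions `t n ∈ φ(t (n + 1))`. -/
def Follows (w : S.Chain) (t : ℕ → Tile d P) : Prop :=
  ∀ n, (w.1.get n).1 = (((t n).1, (t n).2 - S.scale • (t (n + 1)).2), (t (n + 1)).1)

variable (S) in
/-- The `n`-th tile of a path, in its prescribed position. -/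
noncomputable def tileAt (w : S.Chain) (n : ℕ) : Tile d P :=
  (S.extRange (w.1.get n), S.pos w n)

variable (S) in
theorem follows_tileAt (w : S.Chain) : S.Follows w (S.tileAt w) := by
  intro n
  refine Prod.ext (Prod.ext rfl ?_) (w.2 n)
  simp [tileAt, pos, smul_inv_smul₀ S.scale_ne_zero]

theorem Follows.mem_subst {w : S.Chain} {t : ℕ → Tile d P} (h : S.Follows w t) (n : ℕ) :
    t n ∈ S.subst {t (n + 1)} := by
  refine S.mem_subst.2 ⟨_, rfl, ?_⟩
  have := (w.1.get n).2
  rwa [h n] at this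

theorem Follows.drop {w w' : S.Chain} {t : ℕ → Tile d P} (h : S.Follows w t) {k : ℕ}
    (hw : w'.1 = w.1.drop k) : S.Follows w' fun n => t (n + k) := by
  intro n
  have := h (n + k)
  rw [hw, Stream'.get_drop, add_comm k n, this, Nat.add_right_comm]

theorem Follows.translate {w : S.Chain} {t : ℕ → Tile d P} (h : S.Follows w t)
    (x : EuclideanSpace ℝ (Fin d)) :
    S.Follows w fun n => ((t n).1, (t n).2 + (S.scale ^ n)⁻¹ • x) := by
  intro n
  rw [h n]
  have : S.scale • (S.scale ^ (n + 1))⁻¹ • x = (S.scale ^ n)⁻¹ • x := by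
    rw [smul_smul, pow_succ, mul_inv, mul_left_comm, mul_inv_cancel₀ S.scale_ne_zero, mul_one]
  simp only [smul_add, this, add_sub_add_right_eq_sub]

theorem Follows.eq_of_zero_eq {w : S.Chain} {t t' : ℕ → Tile d P} (h : S.Follows w t)
    (h' : S.Follows w t') (h0 : t 0 = t' 0) : t = t' := by
  funext n
  induction n with
  | zero => exact h0
  | succ n ih =>
    have e := (h n).symm.trans (h' n)
    simp only [Prod.mk.injEq, ih, sub_right_inj, true_and] at e
    exact Prod.ext e.2 (smul_right_injective _ S.scale_ne_zero e.1)

theorem Follows.ext {w w' : S.Chain} {t : ℕ → Tile d P} (h : S.Follows w t)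
    (h' : S.Follows w' t) : w = w' :=
  Subtype.ext (Stream'.ext fun n => Subtype.ext ((h n).trans (h' n).symm))

theorem exists_follows {t : ℕ → Tile d P} (h : ∀ n, t n ∈ S.subst {t (n + 1)}) :
    ∃ w, S.Follows w t := by
  refine ⟨⟨fun n => ⟨(((t n).1, (t n).2 - S.scale • (t (n + 1)).2), (t (n + 1)).1), ?_⟩,
    fun n => rfl⟩, fun n => rfl⟩
  obtain ⟨s, rfl, hs⟩ := S.mem_subst.1 (h n)
  exact hs

/-! ### The coding map -/

/-- The `k`-supertile of `t (n + k)` contains `t n` and occurs in an admitted tiling. This supplies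
the auxiliary tilings for the corona limit. -/
theorem ForcesBorderAt.exists_hull_of_follows {k : ℕ} (hb : S.ForcesBorderAt k) {t : ℕ → Tile d P}
    (h : ∀ n, t n ∈ S.subst {t (n + 1)}) (n : ℕ) : ∃ T ∈ S.hull, t n ∈ T := by
  obtain ⟨T, hT, hsub⟩ := hb.1 (t (n + k)).1
  refine ⟨translateTiles T (S.scale ^ k • (t (n + k)).2), S.translate_mem_hull hT _,
    translateTiles_mono hsub _ ?_⟩
  rw [supertile, ← subst_iterate_translate, translateTiles_singleton, zero_add]
  exact S.mem_subst_iterate_of_forall_mem h n k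

theorem ForcesBorder.exists_hierarchy [Finite P] (hb : S.ForcesBorder) {t : ℕ → Tile d P}
    (h : ∀ n, t n ∈ S.subst {t (n + 1)}) : ∃ H, S.IsHierarchy H ∧ ∀ n, t n ∈ H n := by
  obtain ⟨k, hb⟩ := hb.exists_forcesBorderAt
  choose A hA ht using hb.exists_hull_of_follows h
  refine ⟨fun n => S.coronaLimit k A t (n + k), fun n =>
    ⟨hb.coronaLimit_mem_hull hA ht h _, ?_⟩, mem_coronaLimit ht h⟩
  change S.subst (S.coronaLimit k A t (n + 1 + k)) = S.coronaLimit k A t (n + k)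
  rw [Nat.add_right_comm]
  exact hb.subst_coronaLimit hA ht h _

theorem ForcesBorder.hierarchy_unique [Finite P] (hb : S.ForcesBorder) {t : ℕ → Tile d P}
    (h : ∀ n, t n ∈ S.subst {t (n + 1)}) {H H' : ℕ → Set (Tile d P)} (hH : S.IsHierarchy H)
    (hH' : S.IsHierarchy H') (ht : ∀ n, t n ∈ H n) (ht' : ∀ n, t n ∈ H' n) : H = H' := by
  obtain ⟨k, hb⟩ := hb.exists_forcesBorderAt
  funext n
  exact (hb.eq_coronaLimit (fun n => (hH n).1) ht h hH ht n).trans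
    (hb.eq_coronaLimit (fun n => (hH n).1) ht h hH' ht' n).symm

theorem codes_iff {w : S.Chain} {T : Set (Tile d P)} :
    S.Codes w T ↔ ∃ H, H 0 = T ∧ S.IsHierarchy H ∧ ∀ n, S.tileAt w n ∈ H n := by
  constructor
  · rintro ⟨H, h0, h⟩
    exact ⟨H, h0, fun n => ⟨(h n).1, (h n).2.1⟩, fun n => (h n).2.2⟩
  · rintro ⟨H, h0, h, ht⟩
    exact ⟨H, h0, fun n => ⟨(h n).1, (h n).2, ht n⟩⟩

theorem ForcesBorder.exists_hierarchy_tau [Finite P] (hb : S.ForcesBorder) (w : S.Chain) :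
    ∃ H, H 0 = S.tau w ∧ S.IsHierarchy H ∧ ∀ n, S.tileAt w n ∈ H n := by
  obtain ⟨H, hH, ht⟩ := hb.exists_hierarchy (S.follows_tileAt w).mem_subst
  exact codes_iff.1 (Classical.epsilon_spec (p := S.Codes w) ⟨H 0, codes_iff.2 ⟨H, rfl, hH, ht⟩⟩)

/-- Computes τ from any hierarchy in any position: translating level `n` by λ⁻ⁿ times the base shift
moves `t` to the prescribed tiles, and the hierarchy through those is unique. -/
theorem ForcesBorder.tau_eq [Finite P] (hb : S.ForcesBorder) {w : S.Chain} {t : ℕ → Tile d P}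
    (hw : S.Follows w t) {H : ℕ → Set (Tile d P)} (hH : S.IsHierarchy H) (ht : ∀ n, t n ∈ H n) :
    S.tau w = translateTiles (H 0) (-S.tilePuncture (t 0)) := by
  obtain ⟨H', h0, hH', ht'⟩ := hb.exists_hierarchy_tau w
  have e : (fun n => ((t n).1, (t n).2 + (S.scale ^ n)⁻¹ • -S.tilePuncture (t 0))) =
      S.tileAt w := by
    refine (hw.translate _).eq_of_zero_eq (S.follows_tileAt w) ?_
    have hr : S.extRange (w.1.get 0) = (t 0).1 := by simp [extRange, hw 0]
    simp [tileAt, pos, hr, Prototiles.tilePuncture]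
  have := hb.hierarchy_unique (S.follows_tileAt w).mem_subst hH'
    (hH.translate (-S.tilePuncture (t 0))) ht'
    (fun n => e ▸ mem_translateTiles_of_mem (ht n) _)
  rw [← h0, this]
  simp

theorem tilePuncture_tileAt_zero (w : S.Chain) : S.tilePuncture (S.tileAt w 0) = 0 := by
  simp [tileAt, pos, Prototiles.tilePuncture]

theorem ForcesBorder.tau_mem_puncturedHull [Finite P] (hb : S.ForcesBorder) (w : S.Chain) :
    S.tau w ∈ S.puncturedHull := by
  obtain ⟨H, h0, hH, ht⟩ := hb.exists_hierarchy_tau w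
  exact h0 ▸ ⟨(hH 0).1, _, ht 0, tilePuncture_tileAt_zero w⟩

theorem ForcesBorder.tau_injective [Finite P] (hb : S.ForcesBorder) (hrec : S.Recognisable) :
    Function.Injective S.tau := by
  intro w w' h
  obtain ⟨H, h0, hH, ht⟩ := hb.exists_hierarchy_tau w
  obtain ⟨H', h0', hH', ht'⟩ := hb.exists_hierarchy_tau w'
  -- Recognisability makes the hierarchies agree; the paths then agree since the tile at the origin
  -- and all its ancestors are unique.
  obtain rfl : H = H' := hH.eq_of_zero_eq hrec hH' (by rw [h0, h0', h])
  have e : S.tileAt w = S.tileAt w' := by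
    funext n
    induction n with
    | zero =>
      exact (hH 0).1.1.2.eq_of_tilePuncture_eq (ht 0) (ht' 0)
        ((tilePuncture_tileAt_zero w).trans (tilePuncture_tileAt_zero w').symm)
    | succ n ih =>
      refine S.eq_of_mem_subst_iterate (n := 1) (hH (n + 1)).1.1.2 (ht _) (ht' _)
        ((S.follows_tileAt w).mem_subst n) ?_
      rw [ih]
      exact (S.follows_tileAt w').mem_subst n
  exact (S.follows_tileAt w).ext (e ▸ S.follows_tileAt w')

end TileSubstitution

namespace TileSubstitution

variable {d : ℕ} {P : Type*} {S : TileSubstitution d P}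

/-! ### The tiling semigroup is an inverse semigroup -/

theorem IsAdmittedPatch.translate {Q : Set (Tile d P)} (h : S.IsAdmittedPatch Q)
    (x : EuclideanSpace ℝ (Fin d)) : S.IsAdmittedPatch (translateTiles Q x) := by
  obtain ⟨hQ, T, hT, hQT⟩ := h
  exact ⟨hQ.translate x, _, S.translate_mem_hull hT x, translateTiles_mono hQT x⟩

namespace PointedPatch

theorem ext_of_eq {g f : S.PointedPatch} (ht : g.tiles = f.tiles) (hi : g.inTile = f.inTile)
    (ho : g.outTile = f.outTile) : g = f := by
  cases g
  cases f
  cases ht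
  cases hi
  cases ho
  rfl

theorem ext_of_tilePuncture_eq {g f : S.PointedPatch} (ht : g.tiles = f.tiles)
    (ho : S.tilePuncture g.outTile = S.tilePuncture f.outTile) : g = f := by
  have hn := g.isAdmittedPatch.1.2.1
  refine ext_of_eq ht ?_ ?_
  · exact hn.eq_of_tilePuncture_eq g.inTile_mem (ht ▸ f.inTile_mem)
      (g.tilePuncture_inTile.trans f.tilePuncture_inTile.symm)
  · exact hn.eq_of_tilePuncture_eq g.outTile_mem (ht ▸ f.outTile_mem) ho

/-- The doubly pointed patch `[b, Q, a]`. -/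
def of (Q : Set (Tile d P)) (hQ : S.IsAdmittedPatch Q) (a b : Tile d P) (ha : a ∈ Q)
    (hb : b ∈ Q) : S.PointedPatch where
  tiles := translateTiles Q (-S.tilePuncture a)
  inTile := (a.1, a.2 + -S.tilePuncture a)
  outTile := (b.1, b.2 + -S.tilePuncture a)
  inTile_mem := mem_translateTiles_of_mem ha _
  outTile_mem := mem_translateTiles_of_mem hb _
  isAdmittedPatch := hQ.translate _
  tilePuncture_inTile := by rw [Prototiles.tilePuncture_translate, add_neg_cancel]

/-- The underlying set of tiles of the product `g * f`. -/
def mulTiles (g f : S.PointedPatch) : Set (Tile d P) :=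
  f.tiles ∪ translateTiles g.tiles (S.tilePuncture f.outTile)

/-- Connectedness is automatic: inside one tiling the out-tile of `f` and the shifted in-tile of `g`
share a puncture, hence coincide and link the two patches. -/
theorem isAdmittedPatch_mulTiles_iff {g f : S.PointedPatch} :
    S.IsAdmittedPatch (g.mulTiles f) ↔ ∃ T ∈ S.hull, g.mulTiles f ⊆ T := by
  refine ⟨fun h => h.2, fun ⟨T, hT, h⟩ => ⟨⟨?_, hT.1.2.mono h, ?_⟩, T, hT, h⟩⟩
  · exact f.isAdmittedPatch.1.1.union (g.isAdmittedPatch.1.1.image _)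
  · have hin := mem_translateTiles_of_mem g.inTile_mem (S.tilePuncture f.outTile)
    have e : f.outTile = (g.inTile.1, g.inTile.2 + S.tilePuncture f.outTile) :=
      hT.1.2.eq_of_tilePuncture_eq (h (Or.inl f.outTile_mem)) (h (Or.inr hin)) (by
        rw [Prototiles.tilePuncture_translate, g.tilePuncture_inTile, zero_add])
    rw [← e] at hin
    exact f.isAdmittedPatch.1.2.2.union (g.isAdmittedPatch.1.2.2.translate _) f.outTile_mem hin

/-- The product of two doubly pointed patches, if it is not zero. -/
def mul (g f : S.PointedPatch) (h : S.IsAdmittedPatch (g.mulTiles f)) : S.PointedPatch where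
  tiles := g.mulTiles f
  inTile := f.inTile
  outTile := (g.outTile.1, g.outTile.2 + S.tilePuncture f.outTile)
  inTile_mem := Or.inl f.inTile_mem
  outTile_mem := Or.inr ⟨g.outTile, g.outTile_mem, rfl⟩
  isAdmittedPatch := h
  tilePuncture_inTile := f.tilePuncture_inTile

theorem tilePuncture_outTile_mul (g f : S.PointedPatch) (h : S.IsAdmittedPatch (g.mulTiles f)) :
    S.tilePuncture (g.mul f h).outTile = S.tilePuncture g.outTile + S.tilePuncture f.outTile :=
  S.tilePuncture_translate _ _

end PointedPatch

namespace TilingSemigroup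

theorem zero_mul (g : S.TilingSemigroup) : .zero * g = .zero := by
  cases g <;> rfl

theorem mul_zero (g : S.TilingSemigroup) : g * .zero = .zero := by
  cases g <;> rfl

theorem patch_mul_patch {g f : S.PointedPatch} (h : S.IsAdmittedPatch (g.mulTiles f)) :
    (.patch g * .patch f : S.TilingSemigroup) = .patch (g.mul f h) :=
  dif_pos h

theorem patch_mul_patch_eq_zero {g f : S.PointedPatch} (h : ¬ S.IsAdmittedPatch (g.mulTiles f)) :
    (.patch g * .patch f : S.TilingSemigroup) = .zero :=
  dif_neg h

theorem exists_of_mul_eq_patch {x y : S.TilingSemigroup} {k : S.PointedPatch}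
    (h : x * y = .patch k) :
    ∃ (g f : S.PointedPatch) (hgf : S.IsAdmittedPatch (g.mulTiles f)),
      x = .patch g ∧ y = .patch f ∧ k = g.mul f hgf := by
  cases x with
  | zero => rw [zero_mul] at h; cases h
  | patch g =>
    cases y with
    | zero => cases h
    | patch f =>
      by_cases hgf : S.IsAdmittedPatch (g.mulTiles f)
      · rw [patch_mul_patch hgf] at h
        exact ⟨g, f, hgf, rfl, rfl, (TilingSemigroup.patch.inj h).symm⟩
      · rw [patch_mul_patch_eq_zero hgf] at h
        cases h

theorem mul_assoc (a b c : S.TilingSemigroup) : a * b * c = a * (b * c) := by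
  cases a with
  | zero => simp only [zero_mul]
  | patch a =>
  cases b with
  | zero => simp only [zero_mul, mul_zero]
  | patch b =>
  cases c with
  | zero => simp only [mul_zero]
  | patch c =>
  have e₁ : ∀ h, (a.mul b h).mulTiles c = c.tiles ∪ translateTiles b.tiles (S.tilePuncture c.outTile)
      ∪ translateTiles a.tiles (S.tilePuncture b.outTile + S.tilePuncture c.outTile) := by
    intro h
    change c.tiles ∪ translateTiles (b.tiles ∪ translateTiles a.tiles _) _ = _
    rw [translateTiles_union, translateTiles_translateTiles, Set.union_assoc]
  have e₂ : ∀ h, a.mulTiles (b.mul c h) = c.tiles ∪ translateTiles b.tiles (S.tilePuncture c.outTile)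
      ∪ translateTiles a.tiles (S.tilePuncture b.outTile + S.tilePuncture c.outTile) := by
    intro h
    change (c.tiles ∪ translateTiles b.tiles _) ∪ translateTiles a.tiles _ = _
    rw [PointedPatch.tilePuncture_outTile_mul]
  -- Both bracketings are non-zero exactly when this triple union is admitted, as the partial unions
  -- then also fit, up to translation, into the same tiling.
  by_cases h : S.IsAdmittedPatch (c.tiles ∪ translateTiles b.tiles (S.tilePuncture c.outTile)
      ∪ translateTiles a.tiles (S.tilePuncture b.outTile + S.tilePuncture c.outTile))
  · obtain ⟨T, hT, hsub⟩ := h.2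
    have hbc : S.IsAdmittedPatch (b.mulTiles c) :=
      PointedPatch.isAdmittedPatch_mulTiles_iff.2 ⟨T, hT, Set.subset_union_left.trans hsub⟩
    have hab : S.IsAdmittedPatch (a.mulTiles b) := by
      refine PointedPatch.isAdmittedPatch_mulTiles_iff.2
        ⟨_, S.translate_mem_hull hT (-S.tilePuncture c.outTile), ?_⟩
      rw [← translateTiles_subset_iff, PointedPatch.mulTiles, translateTiles_union,
        translateTiles_translateTiles]
      rw [Set.union_assoc] at hsub
      exact Set.subset_union_right.trans hsub
    rw [patch_mul_patch hab, patch_mul_patch hbc, patch_mul_patch (e₁ hab ▸ h),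
      patch_mul_patch (e₂ hbc ▸ h)]
    congr 1
    refine PointedPatch.ext_of_tilePuncture_eq ((e₁ hab).trans (e₂ hbc).symm) ?_
    simp only [PointedPatch.tilePuncture_outTile_mul, add_assoc]
  · have hl : (.patch a * .patch b * .patch c : S.TilingSemigroup) = .zero := by
      by_cases hab : S.IsAdmittedPatch (a.mulTiles b)
      · rw [patch_mul_patch hab, patch_mul_patch_eq_zero]
        rwa [e₁ hab]
      · rw [patch_mul_patch_eq_zero hab, zero_mul]
    have hr : (.patch a * (.patch b * .patch c) : S.TilingSemigroup) = .zero := by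
      by_cases hbc : S.IsAdmittedPatch (b.mulTiles c)
      · rw [patch_mul_patch hbc, patch_mul_patch_eq_zero]
        rwa [e₂ hbc]
      · rw [patch_mul_patch_eq_zero hbc, mul_zero]
    rw [hl, hr]

/-- The inverse `[a, P, b]` of `[b, P, a]`. -/
def inv : S.TilingSemigroup → S.TilingSemigroup
  | .zero => .zero
  | .patch g => .patch
      (PointedPatch.of g.tiles g.isAdmittedPatch g.outTile g.inTile g.outTile_mem g.inTile_mem)

theorem mul_inv_mul (g : S.TilingSemigroup) : g * g.inv * g = g := by
  cases g with
  | zero => rfl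
  | patch g =>
    rw [inv]
    set f := PointedPatch.of g.tiles g.isAdmittedPatch g.outTile g.inTile g.outTile_mem
      g.inTile_mem with hf
    have hx : S.tilePuncture f.outTile = -S.tilePuncture g.outTile := by
      rw [hf, PointedPatch.of, Prototiles.tilePuncture_translate, g.tilePuncture_inTile, zero_add]
    have e : g.mulTiles f = translateTiles g.tiles (-S.tilePuncture g.outTile) := by
      rw [PointedPatch.mulTiles, hx]
      exact Set.union_self _
    have h : S.IsAdmittedPatch (g.mulTiles f) := e ▸ g.isAdmittedPatch.translate _
    have e' : (g.mul f h).mulTiles g = g.tiles := by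
      change g.tiles ∪ translateTiles (g.mulTiles f) _ = _
      rw [e, translateTiles_neg_add_cancel, Set.union_self]
    rw [patch_mul_patch h, patch_mul_patch (e' ▸ g.isAdmittedPatch)]
    congr 1
    refine PointedPatch.ext_of_tilePuncture_eq e' ?_
    rw [PointedPatch.tilePuncture_outTile_mul, PointedPatch.tilePuncture_outTile_mul, hx]
    abel

theorem inv_inv (g : S.TilingSemigroup) : g.inv.inv = g := by
  cases g with
  | zero => rfl
  | patch g =>
    rw [inv, inv]
    congr 1
    have hx : S.tilePuncture (g.inTile.1, g.inTile.2 + -S.tilePuncture g.outTile) =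
        -S.tilePuncture g.outTile := by
      rw [Prototiles.tilePuncture_translate, g.tilePuncture_inTile, zero_add]
    refine PointedPatch.ext_of_tilePuncture_eq ?_ ?_
    · change translateTiles (translateTiles g.tiles _) (-S.tilePuncture (_, _)) = _
      rw [hx, neg_neg, translateTiles_neg_add_cancel]
    · change S.tilePuncture (_, g.outTile.2 + _ + -S.tilePuncture (_, _)) = _
      rw [hx, neg_neg, neg_add_cancel_right]
      rfl

/-- One of the two inclusions behind uniqueness of inverses; exchanging `g` and `f` gives the other.
-/
theorem subset_of_mul_mul_eq {g f : S.PointedPatch}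
    (h : (.patch g * .patch f * .patch g : S.TilingSemigroup) = .patch g) :
    S.tilePuncture f.outTile = -S.tilePuncture g.outTile ∧
      translateTiles f.tiles (S.tilePuncture g.outTile) ⊆ g.tiles := by
  obtain ⟨k, g', hk, h₁, h₂, h₃⟩ := exists_of_mul_eq_patch h
  cases h₂
  obtain ⟨g', f', hg, h₄, h₅, rfl⟩ := exists_of_mul_eq_patch h₁
  cases h₄
  cases h₅
  constructor
  · have := congrArg (fun q : S.PointedPatch => S.tilePuncture q.outTile) h₃
    simp only [PointedPatch.tilePuncture_outTile_mul] at this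
    have h0 := right_eq_add.1 this
    exact eq_neg_of_add_eq_zero_right h0
  · intro t ht
    rw [h₃]
    exact Or.inr (translateTiles_mono Set.subset_union_left _ ht)

theorem eq_inv_of_mul_mul_eq {g f : S.TilingSemigroup} (h : g * f * g = g)
    (h' : f * g * f = f) : f = g.inv := by
  cases g with
  | zero => rw [mul_zero, zero_mul] at h'; exact h'.symm
  | patch g =>
  cases f with
  | zero => rw [mul_zero, zero_mul] at h; cases h
  | patch f =>
    obtain ⟨hx, hsub⟩ := subset_of_mul_mul_eq h
    obtain ⟨-, hsub'⟩ := subset_of_mul_mul_eq h'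
    rw [inv]
    congr 1
    refine PointedPatch.ext_of_tilePuncture_eq ?_ ?_
    · rw [hx] at hsub'
      exact (translateTiles_subset_iff.1 hsub).antisymm hsub'
    · rw [hx, PointedPatch.of, Prototiles.tilePuncture_translate, g.tilePuncture_inTile, zero_add]

end TilingSemigroup

theorem isInverseSemigroup_tilingSemigroup : IsInverseSemigroup S.TilingSemigroup := by
  refine ⟨TilingSemigroup.mul_assoc, fun a => ⟨a.inv, ⟨a.mul_inv_mul, ?_⟩, fun b hb =>
    TilingSemigroup.eq_inv_of_mul_mul_eq hb.1 hb.2⟩⟩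
  have := a.inv.mul_inv_mul
  rwa [TilingSemigroup.inv_inv] at this

end TileSubstitution

namespace TileSubstitution

variable {d : ℕ} {P : Type*} {S : TileSubstitution d P}

/-! ### The action of the tiling semigroup -/

/-- The path is that of the ancestors of `b` in the hierarchy of `w`. Hence the value of
`Function.invFun` in the action is a genuine preimage under τ. -/
theorem ForcesBorder.exists_tau_eq [Finite P] (hb : S.ForcesBorder) {w : S.Chain}
    {b : Tile d P} (h : b ∈ S.tau w) :
    ∃ v, S.tau v = translateTiles (S.tau w) (-S.tilePuncture b) := by
  obtain ⟨H, h0, hH, -⟩ := hb.exists_hierarchy_tau w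
  obtain ⟨t, rfl, ht, hsub⟩ := hH.exists_seq (h0 ▸ h)
  obtain ⟨v, hv⟩ := exists_follows hsub
  exact ⟨v, h0 ▸ hb.tau_eq hv hH ht⟩

theorem ForcesBorder.mem_action_iff [Finite P] (hb : S.ForcesBorder) (hrec : S.Recognisable)
    {g : S.PointedPatch} {w y : S.Chain} :
    y ∈ S.action (.patch g) w ↔ g.tiles ⊆ S.tau w ∧
      S.tau y = translateTiles (S.tau w) (-S.tilePuncture g.outTile) := by
  have hinv : ∀ y : S.Chain, @Function.invFun _ _ ⟨w⟩ S.tau (S.tau y) = y := fun y =>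
    @Function.leftInverse_invFun _ _ ⟨w⟩ _ (hb.tau_injective hrec) y
  constructor
  · rintro ⟨hd, hy⟩
    have hsub := hd.2
    refine ⟨hsub, ?_⟩
    obtain ⟨v, hv⟩ := hb.exists_tau_eq (hsub g.outTile_mem)
    rw [← hv]
    change @Function.invFun _ _ ⟨w⟩ S.tau (translateTiles (S.tau w) _) = y at hy
    rw [← hy, ← hv, hinv]
  · rintro ⟨hsub, hy⟩
    refine ⟨⟨hb.tau_mem_puncturedHull w, hsub⟩, ?_⟩
    change @Function.invFun _ _ ⟨w⟩ S.tau (translateTiles (S.tau w) _) = y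
    rw [← hy, hinv]

theorem ForcesBorder.mem_dom_action_iff [Finite P] (hb : S.ForcesBorder) {g : S.PointedPatch}
    {w : S.Chain} : w ∈ (S.action (.patch g)).Dom ↔ g.tiles ⊆ S.tau w :=
  ⟨fun h => h.2, fun h => ⟨hb.tau_mem_puncturedHull w, h⟩⟩

theorem ForcesBorder.isPartialAction [Finite P] (hb : S.ForcesBorder) (hrec : S.Recognisable) :
    IsPartialAction S.action := by
  refine ⟨fun g w w' y hy hy' => ?_, fun g f => ?_⟩
  · cases g with
    | zero => exact absurd hy (Part.notMem_none _)
    | patch g =>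
      have h := ((hb.mem_action_iff hrec).1 hy).2
      rw [((hb.mem_action_iff hrec).1 hy').2] at h
      refine hb.tau_injective hrec ?_
      have := congrArg (translateTiles · (S.tilePuncture g.outTile)) h
      simpa only [translateTiles_neg_add_cancel] using this.symm
  · funext w
    rw [PFun.comp_apply]
    cases f with
    | zero => rw [TilingSemigroup.mul_zero]; exact (Part.bind_none _).symm
    | patch f =>
    cases g with
    | zero =>
      rw [TilingSemigroup.zero_mul]
      refine (Part.eq_none_iff.2 fun y hy => ?_).symm
      obtain ⟨v, -, hv⟩ := Part.mem_bind_iff.1 hy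
      exact Part.notMem_none _ hv
    | patch g =>
    refine Part.ext fun y => ?_
    refine Iff.trans ?_ Part.mem_bind_iff.symm
    have key : ∀ v, S.tau v = translateTiles (S.tau w) (-S.tilePuncture f.outTile) →
        (f.tiles ⊆ S.tau w ∧ g.tiles ⊆ S.tau v ↔ g.mulTiles f ⊆ S.tau w) := by
      intro v hv
      rw [hv, ← translateTiles_subset_iff, PointedPatch.mulTiles, Set.union_subset_iff]
    by_cases h : S.IsAdmittedPatch (g.mulTiles f)
    · rw [TilingSemigroup.patch_mul_patch h, hb.mem_action_iff hrec,
        PointedPatch.tilePuncture_outTile_mul]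
      change g.mulTiles f ⊆ _ ∧ _ ↔ _
      constructor
      · rintro ⟨h₁, h₂⟩
        have hf : f.tiles ⊆ S.tau w := Set.subset_union_left.trans h₁
        obtain ⟨v, hv⟩ := hb.exists_tau_eq (hf f.outTile_mem)
        refine ⟨v, (hb.mem_action_iff hrec).2 ⟨hf, hv⟩,
          (hb.mem_action_iff hrec).2 ⟨((key v hv).2 h₁).2, ?_⟩⟩
        rw [h₂, hv, translateTiles_translateTiles, neg_add_rev]
      · rintro ⟨v, hv, hy⟩
        obtain ⟨hf, hv⟩ := (hb.mem_action_iff hrec).1 hv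
        obtain ⟨hg, hy⟩ := (hb.mem_action_iff hrec).1 hy
        refine ⟨(key v hv).1 ⟨hf, hg⟩, ?_⟩
        rw [hy, hv, translateTiles_translateTiles, neg_add_rev]
    -- A path in the domain of the composite would exhibit the union inside τ(`w`), making the
    -- product non-zero.
    · rw [TilingSemigroup.patch_mul_patch_eq_zero h]
      refine iff_of_false (Part.notMem_none _) ?_
      rintro ⟨v, hv, hy⟩
      obtain ⟨hf, hv⟩ := (hb.mem_action_iff hrec).1 hv
      obtain ⟨hg, -⟩ := (hb.mem_action_iff hrec).1 hy
      exact h (PointedPatch.isAdmittedPatch_mulTiles_iff.2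
        ⟨_, (hb.tau_mem_puncturedHull w).1, (key v hv).1 ⟨hf, hg⟩⟩)

theorem ForcesBorder.action_eq_some [Finite P] (hb : S.ForcesBorder) (hrec : S.Recognisable)
    {H : ℕ → Set (Tile d P)} (hH : S.IsHierarchy H) {a b : ℕ → Tile d P} (ha : ∀ n, a n ∈ H n)
    (hbH : ∀ n, b n ∈ H n) {v w : S.Chain} (hw : S.Follows w a) (hv : S.Follows v b)
    {g : S.PointedPatch} (hg : g.tiles ⊆ translateTiles (H 0) (-S.tilePuncture (a 0)))
    (hout : S.tilePuncture g.outTile = S.tilePuncture (b 0) - S.tilePuncture (a 0)) :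
    S.action (.patch g) w = Part.some v := by
  rw [Part.eq_some_iff, hb.mem_action_iff hrec, hb.tau_eq hw hH ha, hb.tau_eq hv hH hbH,
    translateTiles_translateTiles, hout]
  refine ⟨hg, ?_⟩
  congr 1
  abel

/-- The path `w` without its first `k` edges. -/
def dropChain (k : ℕ) (w : S.Chain) : S.Chain :=
  ⟨w.1.drop k, fun i => by
    rw [Stream'.get_drop, Stream'.get_drop]
    exact w.2 (k + i)⟩

theorem eq_drop_of_eq_append {z w : S.Chain} {u : List S.Ext} (h : z.1 = u ++ₛ w.1) :
    w.1 = z.1.drop u.length := by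
  rw [h, Stream'.drop_append_stream]

/-- The action between the paths of two tiles is evaluated twice, in the hierarchy and in the
hierarchy without its first levels; both paths merely lose their initial edges. -/
theorem ForcesBorder.restrictsTo [Finite P] (hb : S.ForcesBorder) (hrec : S.Recognisable)
    {H : ℕ → Set (Tile d P)} (hH : S.IsHierarchy H) {a b : ℕ → Tile d P} (ha : ∀ n, a n ∈ H n)
    (hbH : ∀ n, b n ∈ H n) {v w z : S.Chain} (hz : S.Follows z a) (hv : S.Follows v b)
    {u : List S.Ext} (hu : z.1 = u ++ₛ w.1) {g h : S.PointedPatch}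
    (hg : g.tiles ⊆ translateTiles (H 0) (-S.tilePuncture (a 0)))
    (hgout : S.tilePuncture g.outTile = S.tilePuncture (b 0) - S.tilePuncture (a 0))
    (hh : h.tiles ⊆ translateTiles (H u.length) (-S.tilePuncture (a u.length)))
    (hhout : S.tilePuncture h.outTile =
      S.tilePuncture (b u.length) - S.tilePuncture (a u.length)) :
    RestrictsTo S.action (.patch g) z (v.1.take u.length) (.patch h) w := by
  have h₁ := hb.action_eq_some hrec hH ha hbH hz hv hg hgout
  have h₂ : S.action (.patch h) w = Part.some (dropChain u.length v) :=
    hb.action_eq_some hrec (hH.drop u.length) (fun n => ha (n + u.length))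
      (fun n => hbH (n + u.length)) (hz.drop (eq_drop_of_eq_append hu)) (hv.drop rfl)
      (by rwa [Nat.zero_add]) (by rwa [Nat.zero_add])
  rw [RestrictsTo, h₁, h₂, Part.map_some, Part.map_some]
  exact congrArg Part.some (Stream'.append_take_drop u.length v.1).symm

/-! ### Ancestors of the tiles of a patch -/

variable (S) in
/-- The tiles of `T` whose `n`-th inflation contains a tile of `Q`. -/
def ancestors (n : ℕ) (T Q : Set (Tile d P)) : Set (Tile d P) :=
  {s ∈ T | ∃ t ∈ Q, t ∈ S.subst^[n] {s}}

theorem subset_subst_ancestors {n : ℕ} {T Q : Set (Tile d P)} (h : Q ⊆ S.subst^[n] T) :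
    Q ⊆ S.subst^[n] (S.ancestors n T Q) := by
  intro t ht
  obtain ⟨s, hs, hts⟩ := S.mem_subst_iterate.1 (h ht)
  exact S.mem_subst_iterate.2 ⟨s, ⟨hs, t, ht, hts⟩, hts⟩

theorem finite_ancestors [Finite P] (n : ℕ) {T Q : Set (Tile d P)} (hT : S.NonOverlapping T)
    (hQ : Q.Finite) : (S.ancestors n T Q).Finite := by
  refine (hT.finite_of_isBounded
    (hQ.image fun t => (S.scale ^ n)⁻¹ • S.tilePuncture t).isBounded).subset ?_
  rintro s ⟨hs, t, ht, hts⟩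
  exact ⟨hs, _, S.smul_mem_tileSupp_of_mem_subst_iterate hts (S.tilePuncture_mem t), t, ht, rfl⟩

/-- Adjacency passes to ancestors, so a chain of adjacent tiles of `Q` lifts to a chain of
ancestors. -/
theorem connected_ancestors {n : ℕ} {T Q : Set (Tile d P)} (hT : S.NonOverlapping T)
    (hQ : S.Connected Q) (hQT : Q ⊆ S.subst^[n] T) : S.Connected (S.ancestors n T Q) := by
  rintro s ⟨hs, t, ht, hts⟩ s' ⟨hs', t', ht', hts'⟩
  induction hQ t ht t' ht' generalizing s' with
  | refl =>
    rw [S.eq_of_mem_subst_iterate hT hs hs' hts hts']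
  | @tail t₁ t₂ _ h ih =>
    obtain ⟨s₁, hs₁, hts₁⟩ := S.mem_subst_iterate.1 (hQT h.1)
    exact (ih s₁ hs₁ h.1 hts₁).tail ⟨⟨hs₁, t₁, h.1, hts₁⟩, ⟨hs', t₂, ht', hts'⟩,
      S.adjacent_of_mem_subst_iterate hts₁ hts' h.2.2⟩

theorem isAdmittedPatch_ancestors [Finite P] {n : ℕ} {T Q : Set (Tile d P)} (hT : T ∈ S.hull)
    (hQ : S.IsPatch Q) (hQT : Q ⊆ S.subst^[n] T) : S.IsAdmittedPatch (S.ancestors n T Q) :=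
  ⟨⟨finite_ancestors n hT.1.2 hQ.1, hT.1.2.mono fun _ h => h.1,
    connected_ancestors hT.1.2 hQ.2.2 hQT⟩, T, hT, fun _ h => h.1⟩

/-- For `z = u w` in the domain of `g`, the restriction of `g` to `w` can be taken to be the patch
of ancestors of the tiles of `g`. -/
theorem ForcesBorder.exists_restrictsTo_ancestors [Finite P] (hb : S.ForcesBorder)
    (hrec : S.Recognisable) {g : S.PointedPatch} {z w : S.Chain} {u : List S.Ext}
    (hu : z.1 = u ++ₛ w.1) (hz : z ∈ (S.action (.patch g)).Dom) :
    ∃ T ∈ S.hull, ∃ a ∈ T, ∃ b ∈ T, ∃ (v : List S.Ext) (h : S.PointedPatch),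
      v.length = u.length ∧ a = S.tileAt z u.length ∧ g.inTile ∈ S.subst^[u.length] {a} ∧
      g.outTile ∈ S.subst^[u.length] {b} ∧ g.tiles ⊆ S.subst^[u.length] T ∧
      h.tiles = translateTiles (S.ancestors u.length T g.tiles) (-S.tilePuncture a) ∧
      S.tilePuncture h.outTile = S.tilePuncture b - S.tilePuncture a ∧
      w ∈ (S.action (.patch h)).Dom ∧ RestrictsTo S.action (.patch g) z v (.patch h) w := by
  obtain ⟨H, h0, hH, ha⟩ := hb.exists_hierarchy_tau z
  have hsub : g.tiles ⊆ H 0 := h0 ▸ hb.mem_dom_action_iff.1 hz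
  obtain ⟨b, hb0, hbH, hbs⟩ := hH.exists_seq (hsub g.outTile_mem)
  obtain ⟨v, hv⟩ := exists_follows hbs
  have ha0 : S.tileAt z 0 = g.inTile := (hH 0).1.1.2.eq_of_tilePuncture_eq (ha 0)
    (hsub g.inTile_mem) ((tilePuncture_tileAt_zero z).trans g.tilePuncture_inTile.symm)
  have hiter := hH.subst_iterate 0 u.length
  have hin := S.mem_subst_iterate_of_forall_mem (S.follows_tileAt z).mem_subst 0 u.length
  have hout := S.mem_subst_iterate_of_forall_mem hbs 0 u.length
  rw [Nat.zero_add] at hiter hin hout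
  rw [ha0] at hin
  rw [hb0] at hout
  have hQ := isAdmittedPatch_ancestors (hH u.length).1 g.isAdmittedPatch.1
    (hsub.trans hiter.symm.subset)
  have hsuba : translateTiles (S.ancestors u.length (H u.length) g.tiles)
      (-S.tilePuncture (S.tileAt z u.length)) ⊆
        translateTiles (H u.length) (-S.tilePuncture (S.tileAt z u.length)) :=
    translateTiles_mono (fun _ h => h.1) _
  have hp : S.tilePuncture (PointedPatch.of _ hQ (S.tileAt z u.length) (b u.length)
      ⟨ha _, _, g.inTile_mem, hin⟩ ⟨hbH _, _, g.outTile_mem, hout⟩).outTile =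
      S.tilePuncture (b u.length) - S.tilePuncture (S.tileAt z u.length) := by
    rw [sub_eq_add_neg]
    exact S.tilePuncture_translate _ _
  refine ⟨H u.length, (hH _).1, S.tileAt z u.length, ha _, b u.length, hbH _,
    v.1.take u.length, PointedPatch.of _ hQ (S.tileAt z u.length) (b u.length)
      ⟨ha _, _, g.inTile_mem, hin⟩ ⟨hbH _, _, g.outTile_mem, hout⟩,
    Stream'.length_take _ _, rfl, hin, hout, hsub.trans hiter.symm.subset, rfl, hp, ?_, ?_⟩
  · rw [hb.mem_dom_action_iff]
    have htau := hb.tau_eq ((S.follows_tileAt z).drop (eq_drop_of_eq_append hu))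
      (hH.drop u.length) (fun n => ha (n + u.length))
    rw [Nat.zero_add] at htau
    rw [htau]
    exact hsuba
  · refine hb.restrictsTo hrec hH ha hbH (S.follows_tileAt z) hv hu ?_ ?_ hsuba hp
    · rw [ha0, g.tilePuncture_inTile, neg_zero, translateTiles_zero]
      exact hsub
    · rw [ha0, g.tilePuncture_inTile, sub_zero, hb0]

end TileSubstitution

namespace TileSubstitution

variable {d : ℕ} {P : Type*} {S : TileSubstitution d P}

/-! ### Finiteness from finite local complexity -/

variable (S) in
/-- The tiles that are adjacent to `s` in an admitted tiling. -/
def neighbours (s : Tile d P) : Set (Tile d P) :=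
  {t | ∃ T ∈ S.hull, s ∈ T ∧ t ∈ T ∧ S.Adjacent s t}

theorem FLC.finite_neighbours (h : S.FLC) (s : Tile d P) : (S.neighbours s).Finite := by
  refine ((h.image fun q => (q.2.1, s.2 + q.2.2)).union (Set.finite_singleton s)).subset ?_
  rintro t ⟨T, hT, hs, ht, hst⟩
  by_cases hne : s = t
  · exact Or.inr hne.symm
  · obtain ⟨n, p, x, hsub⟩ := hT.2 {s, t}
      (Set.insert_subset hs (Set.singleton_subset_iff.2 ht)) (Set.toFinite _)
    refine Or.inl ⟨(s.1, t.1, t.2 - s.2), ⟨n, p, (s.1, s.2 + -x), ?_, (t.1, t.2 + -x), ?_, ?_,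
      hst.translate (-x), ?_⟩, ?_⟩
    · rw [← sub_eq_add_neg]
      exact mem_translateTiles.1 (hsub (Set.mem_insert _ _))
    · rw [← sub_eq_add_neg]
      exact mem_translateTiles.1 (hsub (Set.mem_insert_of_mem _ rfl))
    · intro e
      rw [Prod.mk.injEq, add_left_inj] at e
      exact hne (Prod.ext e.1 e.2)
    · simp
    · simp

theorem PointedPatch.finite_of_tiles_subset {F : Set (Tile d P)} (hF : F.Finite) :
    {g : S.PointedPatch | g.tiles ⊆ F}.Finite := by
  refine Set.Finite.of_injOn (f := fun g : S.PointedPatch => (g.tiles, g.outTile))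
    (t := F.powerset ×ˢ F) (fun g hg => ⟨hg, hg g.outTile_mem⟩) ?_ (hF.finite_subsets.prod hF)
  intro g _ f _ h
  obtain ⟨h₁, h₂⟩ := Prod.mk.inj h
  exact PointedPatch.ext_of_tilePuncture_eq h₁ (congrArg _ h₂)

/-- All tiles of a star patch are neighbours of its in-tile, which is one of finitely many
prototiles with puncture at the origin. -/
theorem FLC.finite_starPatches [Finite P] (h : S.FLC) : S.starPatches.Finite := by
  have hF : (⋃ p : P, S.neighbours (p, -S.puncture p)).Finite :=
    Set.finite_iUnion fun p => h.finite_neighbours _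
  refine ((PointedPatch.finite_of_tiles_subset hF).image TilingSemigroup.patch).subset ?_
  rintro _ ⟨g, rfl, y, hy⟩
  refine ⟨g, fun t ht => Set.mem_iUnion.2 ⟨g.inTile.1, ?_⟩, rfl⟩
  have e : (g.inTile.1, -S.puncture g.inTile.1) = g.inTile :=
    Prod.ext rfl (neg_eq_of_add_eq_zero_right g.tilePuncture_inTile)
  rw [e]
  obtain ⟨T, hT, hsub⟩ := g.isAdmittedPatch.2
  exact ⟨T, hT, hsub g.inTile_mem, hsub ht, y, hy _ g.inTile_mem, hy t ht⟩

/-! ### Contraction to star patches -/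

/-- The complements of the `c i` cover `K`; `e` is a Lebesgue number of this cover. -/
theorem _root_.IsCompact.exists_forall_le_dist {E : Type*} [PseudoMetricSpace E] {K : Set E}
    (hK : IsCompact K) {ι : Type*} {c : ι → Set E} (hc : ∀ i, IsClosed (c i))
    (h : ∀ x ∈ K, ∃ i, x ∉ c i) : ∃ e > 0, ∀ x ∈ K, ∃ i, ∀ y ∈ c i, e ≤ dist x y := by
  obtain ⟨e, he, h⟩ := lebesgue_number_lemma_of_metric hK (c := fun i => (c i)ᶜ)
    (fun i => (hc i).isOpen_compl) fun x hx => Set.mem_iUnion.2 (h x hx)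
  refine ⟨e, he, fun x hx => ?_⟩
  obtain ⟨i, hi⟩ := h x hx
  refine ⟨i, fun y hy => ?_⟩
  by_contra hlt
  exact hi (Metric.mem_ball'.2 (not_le.1 hlt)) hy

/-- Tiles of an admitted tiling that all come close enough to a point of one of them share a
point. -/
theorem ForcesBorder.exists_common_point [Finite P] (hb : S.ForcesBorder) (hFLC : S.FLC) :
    ∃ e > 0, ∀ T ∈ S.hull, ∀ Q ⊆ T, ∀ s ∈ Q, ∀ x ∈ S.tileSupp s,
      (∀ t ∈ Q, ∃ y ∈ S.tileSupp t, dist x y < e) → ∃ y, ∀ t ∈ Q, y ∈ S.tileSupp t := by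
  obtain ⟨e₀, he₀, hadj⟩ := hb.exists_forall_adjacent
  -- Finitely many sets `Q` of neighbours of a prototile need checking; each without a common point
  -- keeps some tile at a uniform distance from every point of the prototile. Requiring also `e <
  -- e₀` makes close tiles neighbours, so the general case translates to this one.
  have hev : ∀ᶠ e : ℝ in nhdsWithin 0 (Set.Ioi 0), ∀ p : P,
      ∀ Q ∈ (S.neighbours (p, 0)).powerset, (¬ ∃ y, ∀ t ∈ Q, y ∈ S.tileSupp t) →
        ∀ x ∈ S.tileSupp (p, 0), ∃ t ∈ Q, ∀ y ∈ S.tileSupp t, e ≤ dist x y := by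
    refine Filter.eventually_all.2 fun p => ?_
    refine (Filter.eventually_all_finite (hFLC.finite_neighbours (p, 0)).finite_subsets).2
      fun Q _ => ?_
    by_cases hQ : ∃ y, ∀ t ∈ Q, y ∈ S.tileSupp t
    · exact Filter.Eventually.of_forall fun _ h => absurd hQ h
    · obtain ⟨e, he, h⟩ := (S.isCompact_tileSupp (p, 0)).exists_forall_le_dist
        (c := fun t : Q => S.tileSupp t) (fun t => (S.isCompact_tileSupp t).isClosed) (by
          intro x _
          by_contra hn
          push Not at hn
          exact hQ ⟨x, fun t ht => hn ⟨t, ht⟩⟩)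
      filter_upwards [Ioo_mem_nhdsGT he] with e' he' _ x hx
      obtain ⟨t, ht⟩ := h x hx
      exact ⟨t, t.2, fun y hy => he'.2.le.trans (ht y hy)⟩
  obtain ⟨e, ⟨hev, hlt⟩, he⟩ := ((hev.and (Ioo_mem_nhdsGT he₀)).and self_mem_nhdsWithin).exists
  refine ⟨e, he, fun T hT Q hQ s hs x hx hclose => ?_⟩
  by_contra hn
  have hcontra := hev s.1 (translateTiles Q (-s.2)) ?_ ?_ (x + -s.2) ?_
  · obtain ⟨_, ⟨t, ht, rfl⟩, hfar⟩ := hcontra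
    obtain ⟨y, hy, hxy⟩ := hclose t ht
    have := hfar (y + -s.2) (S.mem_tileSupp_translate.2 (by simpa using hy))
    rw [dist_add_right] at this
    exact absurd hxy (not_lt.2 this)
  · rintro _ ⟨t, ht, rfl⟩
    obtain ⟨y, hy, hxy⟩ := hclose t ht
    have hst := (hadj T hT s (hQ hs) t (hQ ht) x hx y hy (hxy.trans hlt.2)).translate (-s.2)
    rw [add_neg_cancel] at hst
    exact ⟨_, S.translate_mem_hull hT (-s.2), mem_translateTiles.2 (by simpa using hQ hs),
      mem_translateTiles_of_mem (hQ ht) _, hst⟩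
  · rintro ⟨y, hy⟩
    refine hn ⟨y + s.2, fun t ht => ?_⟩
    have := S.mem_tileSupp_translate.1 (hy _ (mem_translateTiles_of_mem ht _))
    rwa [sub_neg_eq_add] at this
  · rw [Prototiles.mem_tileSupp] at hx ⊢
    simpa [sub_eq_add_neg] using hx

theorem patch_mem_starPatches_of_tiles_eq {h : S.PointedPatch} {Q : Set (Tile d P)}
    {x : EuclideanSpace ℝ (Fin d)} (hQ : h.tiles = translateTiles Q x)
    (hy : ∃ y, ∀ t ∈ Q, y ∈ S.tileSupp t) :
    TilingSemigroup.patch h ∈ S.starPatches := by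
  obtain ⟨y, hy⟩ := hy
  refine ⟨h, rfl, y + x, fun t ht => ?_⟩
  rw [hQ] at ht
  obtain ⟨t, ht, rfl⟩ := ht
  exact S.mem_tileSupp_translate.2 (by simpa using hy t ht)

theorem ForcesBorder.contractsTo_starPatches [Finite P] (hb : S.ForcesBorder)
    (hrec : S.Recognisable) (hFLC : S.FLC) : ContractsTo S.action S.starPatches := by
  refine ⟨hFLC.finite_starPatches, fun g => ?_⟩
  cases g with
  | zero => exact ⟨0, fun u w z _ _ hz => absurd hz (by rintro ⟨⟩)⟩
  | patch g =>
  obtain ⟨e, he, hstar⟩ := hb.exists_common_point hFLC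
  -- The level-`n` ancestor of `t` contains λ⁻ⁿ x(`t`), which tends to the origin, the puncture of
  -- the in-tile.
  have hlim : ∀ t : Tile d P, ∀ᶠ n : ℕ in Filter.atTop,
      dist 0 ((S.scale ^ n)⁻¹ • S.tilePuncture t) < e := by
    intro t
    have h1 : Filter.Tendsto (fun n : ℕ => (S.scale ^ n)⁻¹ • S.tilePuncture t) Filter.atTop
        (nhds ((0 : ℝ) • S.tilePuncture t)) :=
      ((tendsto_pow_atTop_atTop_of_one_lt S.one_lt_scale).inv_tendsto_atTop).smul_const _
    rw [zero_smul] at h1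
    filter_upwards [h1 (Metric.ball_mem_nhds _ he)] with n hn
    rwa [dist_comm]
  obtain ⟨k, hk⟩ := ((Filter.eventually_all_finite g.isAdmittedPatch.1.1).2
    fun t _ => hlim t).exists
  refine ⟨k, fun u w z hlen hu hz => ?_⟩
  subst hlen
  obtain ⟨T, hT, a, ha, b, -, v, h, hv, -, hin, -, -, htiles, -, -, hres⟩ :=
    hb.exists_restrictsTo_ancestors hrec hu hz
  refine ⟨v, hv, _, patch_mem_starPatches_of_tiles_eq htiles ?_, hres⟩
  refine hstar T hT _ (fun _ h => h.1) a ⟨ha, _, g.inTile_mem, hin⟩ 0 ?_ ?_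
  · have := S.smul_mem_tileSupp_of_mem_subst_iterate hin (S.tilePuncture_mem _)
    rwa [g.tilePuncture_inTile, smul_zero] at this
  · rintro s ⟨-, t, ht, hts⟩
    exact ⟨_, S.smul_mem_tileSupp_of_mem_subst_iterate hts (S.tilePuncture_mem t), hk t ht⟩

theorem ForcesBorder.isSemiNucleus_starPatches [Finite P] (hb : S.ForcesBorder)
    (hrec : S.Recognisable) (hFLC : S.FLC) : IsSemiNucleus S.action S.starPatches := by
  refine ⟨hb.contractsTo_starPatches hrec hFLC, ?_⟩
  rintro _ ⟨g, rfl, y, hy⟩ e w z hz hdom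
  obtain ⟨T, -, a, -, b, -, v, h, hv, -, -, -, -, htiles, -, -, hres⟩ :=
    hb.exists_restrictsTo_ancestors (u := [e]) hrec hz hdom
  obtain ⟨f, rfl⟩ := List.length_eq_one_iff.1 hv
  refine ⟨f, _, patch_mem_starPatches_of_tiles_eq htiles ?_, hres⟩
  exact ⟨_, fun s ⟨_, t, ht, hts⟩ => S.smul_mem_tileSupp_of_mem_subst_iterate hts (hy t ht)⟩

/-! ### Self-similarity -/

theorem ForcesBorder.tileAt_zero_eq [Finite P] (hb : S.ForcesBorder) {w : S.Chain}
    {t : Tile d P} (ht : t ∈ S.tau w) (h : S.tilePuncture t = 0) : S.tileAt w 0 = t := by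
  obtain ⟨H, h0, -, hmem⟩ := hb.exists_hierarchy_tau w
  exact (hb.tau_mem_puncturedHull w).1.1.2.eq_of_tilePuncture_eq (h0 ▸ hmem 0) ht
    ((tilePuncture_tileAt_zero w).trans h.symm)

/-- `h` is the patch of parents of the tiles of `g` in some admitted tiling, where the parent of the
in-tile is `a`. -/
def IsParentPatch (g : S.PointedPatch) (a : Tile d P) (h : S.PointedPatch) : Prop :=
  ∃ T ∈ S.hull, a ∈ T ∧ g.inTile ∈ S.subst {a} ∧ g.tiles ⊆ S.subst T ∧
    h.tiles = translateTiles (S.ancestors 1 T g.tiles) (-S.tilePuncture a) ∧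
    ∃ b ∈ T, g.outTile ∈ S.subst {b} ∧
      S.tilePuncture h.outTile = S.tilePuncture b - S.tilePuncture a

/-- Along a chain of adjacent tiles from the in-tile, whose parent is fixed, each parent is a
neighbour of the preceding one, and so has finitely many possibilities. -/
theorem FLC.finite_isParentPatch (hFLC : S.FLC) (g : S.PointedPatch) (a : Tile d P) :
    {h | IsParentPatch g a h}.Finite := by
  have hfin : ∀ t ∈ g.tiles, {s | ∃ T ∈ S.hull, a ∈ T ∧ g.tiles ⊆ S.subst T ∧
      s ∈ T ∧ g.inTile ∈ S.subst {a} ∧ t ∈ S.subst {s}}.Finite := by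
    intro t ht
    induction g.isAdmittedPatch.1.2.2 _ g.inTile_mem t ht with
    | refl =>
      refine (Set.finite_singleton a).subset ?_
      rintro s ⟨T, hT, ha, -, hs, hin, hin'⟩
      exact S.eq_of_mem_subst_iterate (n := 1) hT.1.2 hs ha hin' hin
    | @tail t₁ t₂ _ h ih =>
      refine ((ih h.1).biUnion fun s _ => hFLC.finite_neighbours s).subset ?_
      rintro s ⟨T, hT, ha, hsub, hs, hin, hts⟩
      obtain ⟨s₁, hs₁, hts₁⟩ := S.exists_mem_subst_singleton (hsub h.1)
      exact Set.mem_biUnion (x := s₁) ⟨T, hT, ha, hsub, hs₁, hin, hts₁⟩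
        ⟨T, hT, hs₁, hs, S.adjacent_of_mem_subst_iterate (n := 1) hts₁ hts h.2.2⟩
  refine (PointedPatch.finite_of_tiles_subset ((g.isAdmittedPatch.1.1.biUnion hfin).image
    fun t => (t.1, t.2 + -S.tilePuncture a))).subset ?_
  rintro h ⟨T, hT, ha, hin, hsub, htiles, -⟩
  change h.tiles ⊆ _
  rw [htiles]
  refine translateTiles_mono ?_ _
  rintro s ⟨hs, t, ht, hts⟩
  exact Set.mem_biUnion ht ⟨T, hT, ha, hsub, hs, hin, hts⟩

/-- Inside a single tiling every tile of `g` has only one parent. This is what makes the domains of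
the restrictions disjoint. -/
theorem IsParentPatch.eq_of_tiles_subset {g h h' : S.PointedPatch} {a : Tile d P}
    (hp : IsParentPatch g a h) (hp' : IsParentPatch g a h') {U : Set (Tile d P)}
    (hU : U ∈ S.hull) (hh : h.tiles ⊆ U) (hh' : h'.tiles ⊆ U) : h = h' := by
  have key : ∀ k : S.PointedPatch, IsParentPatch g a k → k.tiles ⊆ U →
      k.tiles = translateTiles (S.ancestors 1 (translateTiles U (S.tilePuncture a)) g.tiles)
        (-S.tilePuncture a) ∧ ∃ b ∈ translateTiles U (S.tilePuncture a), g.outTile ∈ S.subst {b} ∧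
          S.tilePuncture k.outTile = S.tilePuncture b - S.tilePuncture a := by
    rintro k ⟨T, hT, ha, hin, hsub, htiles, b, hb, hgb, hout⟩ hk
    rw [htiles, translateTiles_subset_iff, neg_neg] at hk
    refine ⟨?_, b, hk ⟨hb, _, g.outTile_mem, hgb⟩, hgb, hout⟩
    rw [htiles]
    congr 1
    refine Set.Subset.antisymm (fun s hs => ⟨hk hs, hs.2⟩) ?_
    rintro s ⟨hs, t, ht, hts⟩
    obtain ⟨s', hs', hts'⟩ := S.mem_subst_iterate.1 (subset_subst_ancestors (n := 1) hsub ht)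
    rwa [S.eq_of_mem_subst_iterate (hU.1.translate _).2 hs (hk hs') hts hts']
  obtain ⟨e, b, hb, hgb, hout⟩ := key h hp hh
  obtain ⟨e', b', hb', hgb', hout'⟩ := key h' hp' hh'
  refine PointedPatch.ext_of_tilePuncture_eq (e.trans e'.symm) ?_
  rw [hout, hout', S.eq_of_mem_subst_iterate (n := 1) (hU.1.translate _).2 hb hb' hgb hgb']

variable (S) in
/-- The tile whose substitution contains `t` in the way that is prescribed by `x`. -/
noncomputable def parentTile (x : S.Ext) (t : Tile d P) : Tile d P :=
  (x.1.2, S.scale⁻¹ • (t.2 - x.1.1.2))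

theorem Follows.one_eq_parentTile {w : S.Chain} {t : ℕ → Tile d P} (h : S.Follows w t) :
    t 1 = S.parentTile (w.1.get 0) (t 0) := by
  rw [parentTile, h 0]
  simp [inv_smul_smul₀ S.scale_ne_zero]

theorem ForcesBorder.exists_eq_cons_of_isParentPatch [Finite P] (hb : S.ForcesBorder)
    {g h : S.PointedPatch} {x : S.Ext} {t : Tile d P} (hp : IsParentPatch g (S.parentTile x t) h)
    {w : S.Chain} (hw : w ∈ (S.action (.patch h)).Dom) :
    ∃ z : S.Chain, z.1 = Stream'.cons x w.1 := by
  refine ⟨⟨Stream'.cons x w.1, ?_⟩, rfl⟩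
  rintro (_ | i)
  -- The domain of `h` forces the tile of `w` at the origin to have the type of the in-tile of `h`,
  -- which is the source of `x`.
  · obtain ⟨T, -, ha, hin, -, htiles, -⟩ := hp
    have hmem : ((S.parentTile x t).1,
        (S.parentTile x t).2 + -S.tilePuncture (S.parentTile x t)) ∈ h.tiles := by
      rw [htiles]
      exact mem_translateTiles_of_mem (T := S.ancestors 1 T g.tiles)
        ⟨ha, _, g.inTile_mem, hin⟩ _
    have := hb.tileAt_zero_eq (hb.mem_dom_action_iff.1 hw hmem) (by
      rw [Prototiles.tilePuncture_translate, add_neg_cancel])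
    exact (congrArg Prod.fst this).symm
  · exact w.2 i

theorem ForcesBorder.exists_edge_of_isParentPatch [Finite P] (hb : S.ForcesBorder)
    (hrec : S.Recognisable) {g h : S.PointedPatch} {x : S.Ext} (hx : x.1.1.1 = g.inTile.1)
    (hp : IsParentPatch g (S.parentTile x g.inTile) h) :
    ∃ y : S.Ext, ∀ z w : S.Chain, z.1 = Stream'.cons x w.1 → w ∈ (S.action (.patch h)).Dom →
      z ∈ (S.action (.patch g)).Dom ∧ RestrictsTo S.action (.patch g) z [y] (.patch h) w := by
  obtain ⟨T, hT, haT, hin, hsub, htiles, b, hbT, hgb, hout⟩ := hp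
  obtain ⟨b, rfl, hgb'⟩ := S.mem_subst.1 hgb
  -- The edge from the out-tile to its parent `b`. It depends on `h` only, because `b` remains the
  -- parent in every tiling containing the parent patch.
  refine ⟨⟨((g.outTile.1, g.outTile.2 - S.scale • b.2), b.1), hgb'⟩, fun z w hz hw => ?_⟩
  have hz' : z.1 = [x] ++ₛ w.1 := hz
  obtain ⟨H, h0, hH, ha⟩ := hb.exists_hierarchy_tau z
  have hz0 : z.1.get 0 = x := by rw [hz]; rfl
  have ha0 : S.tileAt z 0 = g.inTile := by
    refine Prod.ext ?_ ?_
    · rw [← hx, tileAt, hz0]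
      rfl
    · have e1 := tilePuncture_tileAt_zero z
      have e2 := g.tilePuncture_inTile
      rw [Prototiles.tilePuncture] at e1 e2
      have e3 : (S.tileAt z 0).1 = g.inTile.1 := by
        rw [← hx, tileAt, hz0]
        rfl
      rw [e3, ← e2] at e1
      exact add_left_cancel e1
  have ha1 : S.tileAt z 1 = S.parentTile x g.inTile := by
    rw [(S.follows_tileAt z).one_eq_parentTile, hz0, ha0]
  have htau := hb.tau_eq ((S.follows_tileAt z).drop (eq_drop_of_eq_append hz'))
    (hH.drop 1) (fun n => ha (n + 1))
  change S.tau w = translateTiles (H 1) (-S.tilePuncture (S.tileAt z 1)) at htau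
  rw [ha1] at htau
  have hhsub : h.tiles ⊆ translateTiles (H 1) (-S.tilePuncture (S.parentTile x g.inTile)) :=
    htau ▸ hb.mem_dom_action_iff.1 hw
  have hanc : S.ancestors 1 T g.tiles ⊆ H 1 := by
    have := hhsub
    rw [htiles, translateTiles_subset_iff, translateTiles_translateTiles, neg_neg, neg_add_cancel,
      translateTiles_zero] at this
    exact this
  have hg0 : g.tiles ⊆ H 0 := by
    rw [← (hH 0).2]
    exact (subset_subst_ancestors (n := 1) hsub).trans (S.subst_mono hanc)
  have hdom : z ∈ (S.action (.patch g)).Dom := hb.mem_dom_action_iff.2 (h0 ▸ hg0)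
  refine ⟨hdom, ?_⟩
  obtain ⟨t, ht0, htH, hts⟩ := hH.exists_seq (hg0 g.outTile_mem)
  obtain ⟨v, hv⟩ := exists_follows hts
  have ht1 : t 1 = b := S.eq_of_mem_subst_iterate (n := 1) (hH 1).1.1.2 (htH 1)
    (hanc ⟨hbT, _, g.outTile_mem, hgb⟩) (ht0 ▸ hts 0) hgb
  have hres := hb.restrictsTo (g := g) (h := h) hrec hH ha htH (S.follows_tileAt z) hv hz' ?_ ?_ ?_ ?_
  · convert hres using 1
    change _ = [v.1.get 0]
    congr 1
    refine Subtype.ext ?_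
    rw [hv 0, ht0, Nat.zero_add, ht1]
  · rw [ha0, g.tilePuncture_inTile, neg_zero, translateTiles_zero]
    exact hg0
  · rw [ha0, g.tilePuncture_inTile, sub_zero, ht0]
  · change h.tiles ⊆ translateTiles (H 1) (-S.tilePuncture (S.tileAt z 1))
    rwa [ha1]
  · change _ = S.tilePuncture (t 1) - S.tilePuncture (S.tileAt z 1)
    rw [ht1, ha1, hout]

theorem ForcesBorder.exists_isParentPatch [Finite P] (hb : S.ForcesBorder)
    (hrec : S.Recognisable) {g : S.PointedPatch} {x : S.Ext} {z w : S.Chain}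
    (hz : z.1 = Stream'.cons x w.1) (hdom : z ∈ (S.action (.patch g)).Dom) :
    x.1.1.1 = g.inTile.1 ∧ ∃ h : S.PointedPatch,
      IsParentPatch g (S.parentTile x g.inTile) h ∧ w ∈ (S.action (.patch h)).Dom := by
  obtain ⟨T, hT, a, ha, b, hbT, v, h, -, hat, hin, hout, hsub, htiles, hhout, hw, -⟩ :=
    hb.exists_restrictsTo_ancestors (u := [x]) hrec hz hdom
  have hz0 : z.1.get 0 = x := by rw [hz]; rfl
  have ha0 : S.tileAt z 0 = g.inTile :=
    hb.tileAt_zero_eq (hb.mem_dom_action_iff.1 hdom g.inTile_mem) g.tilePuncture_inTile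
  have ha1 : a = S.parentTile x g.inTile := by
    rw [hat, ← ha0, ← hz0]
    exact (S.follows_tileAt z).one_eq_parentTile
  refine ⟨?_, h, ha1 ▸ ⟨T, hT, ha, hin, hsub, htiles, b, hbT, hout, hhout⟩, hw⟩
  rw [← ha0, tileAt, hz0]
  rfl

theorem ForcesBorder.isSelfSimilar [Finite P] (hb : S.ForcesBorder) (hrec : S.Recognisable)
    (hFLC : S.FLC) : IsSelfSimilar S.action := by
  refine ⟨isInverseSemigroup_tilingSemigroup, hb.isPartialAction hrec, fun g x => ?_⟩
  cases g with
  | zero =>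
    refine ⟨0, Fin.elim0, Fin.elim0, fun i => i.elim0, ?_, fun i => i.elim0⟩
    ext z
    simp only [Set.mem_iUnion, IsEmpty.exists_iff, false_iff]
    rintro ⟨-, _, ⟨⟩, -⟩
  | patch g =>
  by_cases hx : x.1.1.1 = g.inTile.1
  · have hfin := hFLC.finite_isParentPatch g (S.parentTile x g.inTile)
    -- The restrictions are all the possible parent patches; when the range of `x` is not the type
    -- of the in-tile, no path starting with `x` lies in the domain and none are needed.
    obtain ⟨k, ⟨e⟩⟩ := finite_iff_exists_equiv_fin.1 hfin.to_subtype
    choose y hy using fun i : Fin k =>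
      hb.exists_edge_of_isParentPatch hrec hx (e.symm i).2
    refine ⟨k, y, fun i => .patch (e.symm i).1, fun i j hij => ?_, ?_, fun i z w hz hw =>
      (hy i z w hz hw).2⟩
    · refine Set.disjoint_left.2 fun w hw hw' => hij ?_
      exact e.symm.injective (Subtype.ext ((e.symm i).2.eq_of_tiles_subset (e.symm j).2
        (hb.tau_mem_puncturedHull w).1 (hb.mem_dom_action_iff.1 hw)
        (hb.mem_dom_action_iff.1 hw')))
    · ext z
      simp only [Set.mem_iUnion]
      constructor
      · rintro ⟨i, w, hw, rfl⟩
        obtain ⟨z, hz⟩ := hb.exists_eq_cons_of_isParentPatch (e.symm i).2 hw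
        exact ⟨rfl, z, (hy i z w hz hw).1, hz⟩
      · rintro ⟨hzx, z', hz', rfl⟩
        have hz : z'.1 = Stream'.cons x (dropChain 1 z').1 := by
          rw [← hzx]
          exact (Stream'.eta z'.1).symm
        obtain ⟨-, h, hp, hw⟩ := hb.exists_isParentPatch hrec hz hz'
        refine ⟨e ⟨h, hp⟩, dropChain 1 z', ?_, hz⟩
        rwa [Equiv.symm_apply_apply]
  · refine ⟨0, Fin.elim0, Fin.elim0, fun i => i.elim0, ?_, fun i => i.elim0⟩
    ext z
    simp only [Set.mem_iUnion, IsEmpty.exists_iff, false_iff]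
    rintro ⟨hzx, z', hz', rfl⟩
    have hz : z'.1 = Stream'.cons x (dropChain 1 z').1 := by
      rw [← hzx]
      exact (Stream'.eta z'.1).symm
    exact hx (hb.exists_isParentPatch hrec hz hz').1

end TileSubstitution

/-! ### The proposition -/

theorem mainTheorem3 {d : ℕ} {P : Type*} [Finite P] (S : TileSubstitution d P)
    (hFLC : S.FLC) (hrec : S.Recognisable) (hborder : S.ForcesBorder) :
    (∀ g : S.TilingSemigroup, ∃ k : ℕ, ∀ (u : List S.Ext) (w z : S.Chain),
      u.length = k → z.1 = u ++ₛ w.1 → z ∈ (S.action g).Dom →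
        ∃ v : List S.Ext, v.length = k ∧ ∃ h : S.PointedPatch,
          (h.inTile = h.outTile ∨ S.Adjacent h.inTile h.outTile) ∧
          RestrictsTo S.action g z v (.patch h) w) ∧
    IsContracting S.action ∧
    IsSemiNucleus S.action S.starPatches := by
  refine ⟨fun g => ?_, ⟨hborder.isSelfSimilar hrec hFLC, _,
    hborder.contractsTo_starPatches hrec hFLC⟩, hborder.isSemiNucleus_starPatches hrec hFLC⟩
  obtain ⟨k, hk⟩ := (hborder.contractsTo_starPatches hrec hFLC).2 g
  refine ⟨k, fun u w z hu hz hdom => ?_⟩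
  -- The common point `y` of the star patch lies in both its in-tile and its out-tile, which are
  -- therefore adjacent.
  obtain ⟨v, hv, _, ⟨h, rfl, y, hy⟩, hres⟩ := hk u w z hu hz hdom
  exact ⟨v, hv, h, Or.inr ⟨y, hy _ h.inTile_mem, hy _ h.outTile_mem⟩, hres⟩
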